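/- Let $k$ be an algebraically closed field of characteristic zero, and let $Z \subset \mathbf{P}^2_k$ be a set of $6$ distinct points, no three of which are collinear. A point $p \in \mathbf{P}^2 \setminus Z$ is called a star point of $Z$ if, for some ordering $z_1, \dots, z_6$ of the points of $Z$, the three lines $\overline{z_1z_2}$, $\overline{z_3z_4}$, $\overline{z_5z_6}$ all pass through $p$. Suppose that $Z$ is star-free, that is, that it has no star points. Regard $Z$ as a reduced subscheme of length $6$, and let $W \subset \mathbf{P}^2$ be a closed subscheme of length $6$ that lies in the boundary of the $\mathrm{PGL}_3(k)$-orbit of $Z$: $W$ belongs to the Zariski closure of this orbit in the Hilbert scheme of $6$ points of $\mathbf{P}^2$, but not to the orbit itself. Then there exists a line in $\mathbf{P}^2$ containing at least $4$ distinct points of $W$, or there exists a point of $\mathbf{P}^2$ at which $W$ has multiplicity at least $4$ (that is, at which the local ring of $W$ has length at least $4$). -/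

import Mathlib

open scoped LinearAlgebra.Projectivization MatrixGroups

attribute [local instance] MvPolynomial.gradedAlgebra

/-! ## Points and lines of the projective plane -/

namespace SixPoints

section Plane

variable {k : Type*} [Field k]

/-- The (closed) points of the projective plane: lines through the origin of `k³`. -/
abbrev P2 (k : Type*) [Field k] : Type _ := ℙ k (Fin 3 → k)

/-- A line of the projective plane, given as a two-dimensional subspace of `k³`. -/
def IsLine (L : Submodule k (Fin 3 → k)) : Prop := Module.finrank k L = 2

/-- The point `p` lies on the line (or other linear subspace) `L`. -/
def LiesOn (p : P2 k) (L : Submodule k (Fin 3 → k)) : Prop := p.submodule ≤ L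

/-- The linear subspace spanned by two points: the line joining them when they are distinct. -/
def join (p q : P2 k) : Submodule k (Fin 3 → k) := p.submodule ⊔ q.submodule

/-- No three distinct points of `Z` are collinear. -/
def NoThreeCollinear (Z : Finset (P2 k)) : Prop :=
  ∀ a ∈ Z, ∀ b ∈ Z, ∀ c ∈ Z, a ≠ b → a ≠ c → b ≠ c →
    ¬ ∃ L, IsLine L ∧ LiesOn a L ∧ LiesOn b L ∧ LiesOn c L

/-- `p` is a star point of `Z`: it is not in `Z` and, for some ordering `z₀, …, z₅` of the (six)
points of `Z`, the three lines `z₀z₁`, `z₂z₃`, `z₄z₅` all pass through `p`. -/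
def IsStarPoint (Z : Finset (P2 k)) (p : P2 k) : Prop :=
  p ∉ Z ∧ ∃ z : Fin 6 → P2 k, Function.Injective z ∧ Set.range z = (Z : Set (P2 k)) ∧
    LiesOn p (join (z 0) (z 1)) ∧ LiesOn p (join (z 2) (z 3)) ∧ LiesOn p (join (z 4) (z 5))

/-- `Z` has no star points. -/
def StarFree (Z : Finset (P2 k)) : Prop := ∀ p, ¬ IsStarPoint Z p

end Plane

/-! ## Closed subschemes of finite length of the projective plane -/

section Subschemes

variable {k : Type*} [Field k]

/-- The homogeneous coordinate ring of the projective plane. -/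
abbrev Coord (k : Type*) [Field k] : Type _ := MvPolynomial (Fin 3) k

/-- The space of forms of degree `d`. -/
abbrev Form (k : Type*) [Field k] : ℕ → Submodule k (Coord k) :=
  MvPolynomial.homogeneousSubmodule (Fin 3) k

/-- Restriction of polynomials to the line through the origin of `k³` that the point `p` is:
`f ↦ f (t • p)`, a polynomial in the parameter `t`. -/
noncomputable def restrictToPoint (p : P2 k) : Coord k →ₐ[k] Polynomial k :=
  MvPolynomial.aeval fun i => Polynomial.C (p.rep i) * Polynomial.X

/-- The homogeneous prime ideal of the point `p`. -/
noncomputable def pointIdeal (p : P2 k) : Ideal (Coord k) := RingHom.ker (restrictToPoint p)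

instance (p : P2 k) : (pointIdeal p).IsPrime := RingHom.ker_isPrime _

/-- The degree `d` part of an ideal, as a subspace of the space of forms of degree `d`. -/
noncomputable def degreePart (I : Ideal (Coord k)) (d : ℕ) : Submodule k (Form k d) :=
  (I.restrictScalars k).comap (Form k d).subtype

/-- A point of the Hilbert scheme of `n` points of the projective plane, that is, a closed
subscheme of length `n`, given by its saturated homogeneous ideal. -/
@[ext]
structure Hilb (k : Type*) [Field k] (n : ℕ) where
  /-- The homogeneous ideal of the subscheme. -/
  ideal : Ideal (Coord k)
  homogeneous : ideal.IsHomogeneous (Form k)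
  /-- The ideal is saturated with respect to the irrelevant ideal `(X₀, X₁, X₂)`. -/
  saturated : ∀ f, (∀ i, MvPolynomial.X i * f ∈ ideal) → f ∈ ideal
  /-- The Hilbert polynomial is the constant `n`. -/
  length : ∃ d₀, ∀ d ≥ d₀, Module.finrank k (Form k d ⧸ degreePart ideal d) = n

namespace Hilb

variable {n : ℕ}

/-- The set of points of the subscheme `W`. -/
def support (W : Hilb k n) : Set (P2 k) := {p | W.ideal ≤ pointIdeal p}

/-- The local ring of the projective plane at `p`: fractions of forms of the same degree
whose denominator does not vanish at `p`. -/
abbrev LocalRing (p : P2 k) : Type _ := HomogeneousLocalization.AtPrime (Form k) (pointIdeal p)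

/-- The ideal of `W` in the local ring of the projective plane at `p`: the fractions `a / b`
whose image in the full localization lies in the extension of the ideal of `W`. -/
noncomputable def localIdeal (W : Hilb k n) (p : P2 k) : Ideal (LocalRing p) :=
  (W.ideal.map (algebraMap (Coord k) (Localization.AtPrime (pointIdeal p)))).comap
    (algebraMap (LocalRing p) (Localization.AtPrime (pointIdeal p)))

/-- The multiplicity of `W` at `p`: the length of the local ring of `W` at `p`. -/
noncomputable def multiplicity (W : Hilb k n) (p : P2 k) : ℕ∞ :=
  Module.length (LocalRing p) (LocalRing p ⧸ W.localIdeal p)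

end Hilb

/-! ### Finite sets of points as reduced subschemes -/

theorem coeff_restrictToPoint (p : P2 k) (f : Coord k) (d : ℕ) :
    (restrictToPoint p f).coeff d =
      MvPolynomial.eval p.rep (MvPolynomial.homogeneousComponent d f) := by
  induction f using MvPolynomial.induction_on' with
  | add a b ha hb => simp [ha, hb]
  | monomial m a =>
    have h1 : restrictToPoint p (MvPolynomial.monomial m a) =
        Polynomial.C (a * m.prod fun i e => p.rep i ^ e) * Polynomial.X ^ m.degree := by
      rw [restrictToPoint, MvPolynomial.aeval_monomial]
      simp only [mul_pow, Finsupp.prod_mul, Polynomial.algebraMap_eq, map_mul, mul_assoc]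
      congr 2
      · simp [Finsupp.prod]
      · simp [Finsupp.prod, Finset.prod_pow_eq_pow_sum, Finsupp.degree_apply]
    rw [h1, Polynomial.coeff_C_mul, Polynomial.coeff_X_pow]
    rw [MvPolynomial.homogeneousComponent_of_mem
      (MvPolynomial.isHomogeneous_monomial a (rfl : m.degree = m.degree))]
    by_cases h : d = m.degree
    · simp [h, MvPolynomial.eval_monomial]
    · simp [h]

theorem mem_pointIdeal (p : P2 k) (f : Coord k) :
    f ∈ pointIdeal p ↔
      ∀ d, MvPolynomial.eval p.rep (MvPolynomial.homogeneousComponent d f) = 0 := by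
  rw [pointIdeal, RingHom.mem_ker, Polynomial.ext_iff]
  simp [← coeff_restrictToPoint]

theorem mem_pointIdeal_of_form (p : P2 k) {f : Coord k} {d : ℕ} (hf : f ∈ Form k d) :
    f ∈ pointIdeal p ↔ MvPolynomial.eval p.rep f = 0 := by
  rw [mem_pointIdeal]
  constructor
  · intro h
    simpa [MvPolynomial.homogeneousComponent_of_mem hf] using h d
  · intro h e
    rw [MvPolynomial.homogeneousComponent_of_mem hf]
    split_ifs <;> simp [h]

/-- The ideal generated by the forms vanishing on `Z`. -/
noncomputable def vanishingIdeal (Z : Finset (P2 k)) : Ideal (Coord k) := ⨅ z ∈ Z, pointIdeal z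

theorem mem_vanishingIdeal (Z : Finset (P2 k)) (f : Coord k) :
    f ∈ vanishingIdeal Z ↔ ∀ z ∈ Z, f ∈ pointIdeal z := by
  simp [vanishingIdeal, Submodule.mem_iInf]

theorem vanishingIdeal_homogeneous (Z : Finset (P2 k)) :
    (vanishingIdeal Z).IsHomogeneous (Form k) := by
  intro d f hf
  rw [mem_vanishingIdeal] at hf ⊢
  intro z hz
  have h := (mem_pointIdeal z f).1 (hf z hz) d
  have h2 : (DirectSum.decompose (Form k) f d : Coord k) =
      MvPolynomial.homogeneousComponent d f := by
    exact MvPolynomial.decomposition.decompose'_apply f d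
  rw [h2, mem_pointIdeal_of_form z (MvPolynomial.homogeneousComponent_mem d f)]
  exact h

theorem vanishingIdeal_saturated (Z : Finset (P2 k)) (f : Coord k)
    (h : ∀ i, MvPolynomial.X i * f ∈ vanishingIdeal Z) : f ∈ vanishingIdeal Z := by
  rw [mem_vanishingIdeal]
  intro z hz
  by_contra hf
  apply z.rep_nonzero
  ext i
  have h1 := (mem_vanishingIdeal Z _).1 (h i) z hz
  have h2 := ((inferInstance : (pointIdeal z).IsPrime).mem_or_mem h1).resolve_right hf
  rw [mem_pointIdeal_of_form z (d := 1) (MvPolynomial.isHomogeneous_X k i)] at h2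
  simpa using h2

/-- A linear form with prescribed coefficients. -/
theorem exists_linear_form (φ : Module.Dual k (Fin 3 → k)) :
    ∃ l ∈ Form k 1, ∀ v, MvPolynomial.eval v l = φ v := by
  refine ⟨∑ i, MvPolynomial.C (φ (Pi.single i 1)) * MvPolynomial.X i, ?_, ?_⟩
  · refine Submodule.sum_mem _ fun i _ => ?_
    rw [← MvPolynomial.smul_eq_C_mul]
    exact Submodule.smul_mem _ _ (MvPolynomial.isHomogeneous_X k i)
  · intro v
    conv_rhs => rw [← Finset.univ_sum_single v, map_sum]
    simp only [map_sum, map_mul, MvPolynomial.eval_C, MvPolynomial.eval_X]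
    refine Finset.sum_congr rfl fun i _ => ?_
    rw [show (Pi.single i (v i) : Fin 3 → k) = v i • Pi.single i 1 by simp [← Pi.single_smul]]
    rw [map_smul, smul_eq_mul, mul_comm]

theorem exists_separating_form (z w : P2 k) (h : z ≠ w) :
    ∃ l ∈ Form k 1, MvPolynomial.eval w.rep l = 0 ∧ MvPolynomial.eval z.rep l ≠ 0 := by
  have hz : z.rep ∉ Submodule.span k {w.rep} := by
    intro hm
    obtain ⟨a, ha⟩ := Submodule.mem_span_singleton.1 hm
    apply h
    rw [← z.mk_rep, ← w.mk_rep, Projectivization.mk_eq_mk_iff']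
    exact ⟨a, ha⟩
  obtain ⟨φ, h1, h2⟩ := Submodule.exists_le_ker_of_notMem hz
  obtain ⟨l, hl, hl'⟩ := exists_linear_form φ
  refine ⟨l, hl, ?_, ?_⟩
  · rw [hl']; exact h2 (Submodule.mem_span_singleton_self _)
  · rw [hl']; exact h1

theorem exists_interpolating_form [DecidableEq (P2 k)] (Z : Finset (P2 k)) (z : P2 k) (d : ℕ)
    (hd : Z.card ≤ d) :
    ∃ f ∈ Form k d, MvPolynomial.eval z.rep f ≠ 0 ∧
      ∀ w ∈ Z, w ≠ z → MvPolynomial.eval w.rep f = 0 := by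
  induction Z using Finset.induction_on generalizing d with
  | empty =>
    obtain ⟨i, hi⟩ := Function.ne_iff.1 z.rep_nonzero
    exact ⟨MvPolynomial.X i ^ d, MvPolynomial.isHomogeneous_X_pow i d,
      by simpa using fun h => absurd h hi, by simp⟩
  | insert w Z hw ih =>
    rw [Finset.card_insert_of_notMem hw] at hd
    obtain ⟨e, rfl⟩ : ∃ e, d = e + 1 := ⟨d - 1, by omega⟩
    obtain ⟨f, hf, hfz, hfZ⟩ := ih e (by omega)
    obtain ⟨l, hl, hlz, hlw⟩ : ∃ l ∈ Form k 1, MvPolynomial.eval z.rep l ≠ 0 ∧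
        (w ≠ z → MvPolynomial.eval w.rep l = 0) := by
      by_cases hwz : w = z
      · obtain ⟨i, hi⟩ := Function.ne_iff.1 z.rep_nonzero
        exact ⟨MvPolynomial.X i, MvPolynomial.isHomogeneous_X k i, by simpa using hi,
          fun h => absurd hwz h⟩
      · obtain ⟨l, hl, h1, h2⟩ := exists_separating_form z w (Ne.symm hwz)
        exact ⟨l, hl, h2, fun _ => h1⟩
    refine ⟨f * l, MvPolynomial.IsHomogeneous.mul hf hl, by simp [hfz, hlz], ?_⟩
    intro v hv hvz
    rcases Finset.mem_insert.1 hv with rfl | hv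
    · simp [hlw hvz]
    · simp [hfZ v hv hvz]

theorem finrank_vanishingIdeal (Z : Finset (P2 k)) (d : ℕ) (hd : Z.card ≤ d) :
    Module.finrank k (Form k d ⧸ degreePart (vanishingIdeal Z) d) = Z.card := by
  classical
  let ev : Form k d →ₗ[k] (Z → k) :=
    { toFun := fun f z => MvPolynomial.eval z.1.rep f.1
      map_add' := by intro f g; ext z; simp
      map_smul' := by intro c f; ext z; simp }
  have hker : LinearMap.ker ev = degreePart (vanishingIdeal Z) d := by
    ext f
    have h : f ∈ degreePart (vanishingIdeal Z) d ↔ f.1 ∈ vanishingIdeal Z := Iff.rfl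
    rw [h, LinearMap.mem_ker, mem_vanishingIdeal, funext_iff]
    constructor
    · intro h z hz
      exact (mem_pointIdeal_of_form z f.2).2 (h ⟨z, hz⟩)
    · intro h z
      exact (mem_pointIdeal_of_form z.1 f.2).1 (h z.1 z.2)
  have hsurj : Function.Surjective ev := by
    rw [← LinearMap.range_eq_top, eq_top_iff, ← (Pi.basisFun k Z).span_eq, Submodule.span_le]
    rintro _ ⟨z, rfl⟩
    obtain ⟨f, hf, hfz, hfZ⟩ := exists_interpolating_form Z z.1 d hd
    refine ⟨(MvPolynomial.eval z.1.rep f)⁻¹ • ⟨f, hf⟩, ?_⟩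
    ext w
    rw [Pi.basisFun_apply, map_smul, Pi.smul_apply, smul_eq_mul]
    change _ * MvPolynomial.eval w.1.rep f = _
    by_cases hw : w = z
    · subst hw; simp [hfz]
    · rw [hfZ w.1 w.2 (fun h => hw (Subtype.ext h))]; simp [hw]
  rw [← hker, (ev.quotKerEquivOfSurjective hsurj).finrank_eq]
  simp

/-- A set of `n` points, as a reduced subscheme of length `n`. -/
noncomputable def Hilb.ofPoints {n : ℕ} (Z : Finset (P2 k)) (hZ : Z.card = n) : Hilb k n where
  ideal := vanishingIdeal Z
  homogeneous := vanishingIdeal_homogeneous Z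
  saturated := vanishingIdeal_saturated Z
  length := ⟨Z.card, fun d hd => (finrank_vanishingIdeal Z d hd).trans hZ⟩

end Subschemes

/-! ## The Zariski topology of the Hilbert scheme -/

section Topology

variable {k : Type*} [Field k]

/-- The Zariski topology on the affine space `σ → k`: its basic open sets are the non-vanishing
loci of polynomials. -/
@[reducible] noncomputable def zariskiTopology (σ k : Type*) [Field k] : TopologicalSpace (σ → k) :=
  TopologicalSpace.generateFrom
    {U | ∃ F : MvPolynomial σ k, U = {x | MvPolynomial.eval x F ≠ 0}}

variable (k) in
/-- Surjective linear maps from `V` to `kⁿ`. -/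
abbrev Frame (V : Type*) [AddCommGroup V] [Module k V] (n : ℕ) : Type _ :=
  {A : V →ₗ[k] (Fin n → k) // Function.Surjective A}

variable (k) in
/-- The Zariski topology on the set of surjective linear maps `V → kⁿ`, an open subset of the
affine space `Hom(V, kⁿ)` on which the functions `A ↦ (A v)ᵢ` generate the algebra of
polynomial functions. -/
@[reducible] noncomputable def frameTopology (V : Type*) [AddCommGroup V] [Module k V] (n : ℕ) :
    TopologicalSpace (Frame k V n) :=
  (zariskiTopology (V × Fin n) k).induced fun A vi => A.1 vi.1 vi.2

variable (k) in
/-- The Zariski topology on the disjoint union of all Grassmannians of a finite-dimensional space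
`V`: the Grassmannian of subspaces of codimension `n` carries the quotient topology with respect
to the map that sends a surjective linear map `V → kⁿ` to its kernel. -/
@[reducible] noncomputable def grassmannianTopology (V : Type*) [AddCommGroup V] [Module k V] :
    TopologicalSpace (Submodule k V) :=
  ⨆ n : ℕ, (frameTopology k V n).coinduced fun A => LinearMap.ker A.1

/-- The Zariski topology on (the closed points of) the Hilbert scheme of `n` points of the
projective plane: the topology induced by the embeddings `W ↦ H⁰(I_W(d)) ⊆ H⁰(O(d))` into
Grassmannians. These are closed embeddings of the Hilbert scheme for all `d ≥ n`, as `n` is the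
Gotzmann number of the constant Hilbert polynomial `n`. -/
noncomputable instance (n : ℕ) : TopologicalSpace (Hilb k n) :=
  ⨅ d : {d : ℕ // n ≤ d},
    (grassmannianTopology k (Form k d.1)).induced fun W => degreePart W.ideal d.1

/-- The orbit of (the reduced subscheme) `Z` under the group `PGL₃`, in the Hilbert scheme. -/
def orbit {n : ℕ} (Z : Finset (P2 k)) (hZ : Z.card = n) : Set (Hilb k n) :=
  Set.range fun g : PGL(3, k) =>
    Hilb.ofPoints (Z.map (MulAction.toPerm g).toEmbedding) ((Finset.card_map _).trans hZ)

end Topology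

end SixPoints

/-!
Let `W` be a limit of translates `g Z` of the six points `Z`. The matrix `g`, taken up to scalars,
and the points `g z`, for `z` in `Z`, vary in a product of projective spaces. By elimination theory
they have limits along with `g Z`: a nonzero matrix `f`, and points `w z` of the plane with
`w z = f z` whenever `f z` is nonzero (`exists_limit_of_mem_closure_orbit`). The points `w z` lie
on `W`, and the multiplicity of `W` at `p` is at least the number of `z` with `w z = p`. The theorem
follows from the rank of `f`:

* If `f` is invertible, then `W` contains the six points `f z`, hence is the translate `f Z`.
* If `f` has rank two, it is the projection from a point `q` to a line, which contains the images of
  all points of `Z` other than `q`. As no three points of `Z` are collinear, a fibre of the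
  projection has at most two points, and the other five points have distinct images if `q` is in
  `Z`. If there were at most three images, the fibres would be three pairs and `q` a star point. So
  `W` has at least four points on the line (`four_le_card_of_rank_two`).
* If `f` has rank one, it maps all points of `Z` outside of a line to one point `p`. At most two
  points of `Z` are on the line, so `W` has multiplicity at least four at `p`
  (`four_le_card_of_rank_one`).

That the relation between `W` and the limits is closed is seen from norms. Let `A` be the quotient
map from forms of degree `e + 1` to the homogeneous coordinate ring of a subscheme of length `n`.
The determinant of the matrix with columns `A (b j * l)`, for `n` forms `b j` of degree `e`, is a
polynomial in the linear form `l`. For a set of points it is proportional to the product of the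
values of `l` at these points. This is an algebraic condition on `A` and the points
(`IsLimitDatum`), so it carries over to the limit. In the limit it determines the characteristic
polynomial of multiplication by a quotient of linear forms `m / l` on the homogeneous coordinate
ring of `W`, and the generalized eigenspace for the eigenvalue zero embeds in the local ring of `W`
at the point where `m` vanishes (`Hilb.card_le_multiplicity`).
-/

namespace SixPoints

/-! ### Elimination theory -/

section Elimination

open MvPolynomial

variable {k : Type*} [Field k] {ρ : Type*}

/-- A subset of the affine space `ρ → k` that is the common zero locus of the polynomials
vanishing on it. The index type `ρ` may be infinite. -/
def IsZeroLocus (C : Set (ρ → k)) : Prop :=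
  ∀ x, (∀ F : MvPolynomial ρ k, (∀ y ∈ C, eval y F = 0) → eval x F = 0) → x ∈ C

theorem isZeroLocus_setOf_eval_eq_zero {ι : Sort*} (F : ι → MvPolynomial ρ k) :
    IsZeroLocus {x : ρ → k | ∀ i, eval x (F i) = 0} :=
  fun _ hx i => hx (F i) fun _ hy => hy i

theorem IsZeroLocus.isClosed {C : Set (ρ → k)} (hC : IsZeroLocus C) :
    @IsClosed _ (zariskiTopology ρ k) C := by
  let _ := zariskiTopology ρ k
  rw [← isOpen_compl_iff]
  have : Cᶜ = ⋃ F : {F : MvPolynomial ρ k // ∀ y ∈ C, eval y F = 0},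
      {x | eval x F.1 ≠ 0} := by
    ext x
    simp only [Set.mem_compl_iff, Set.mem_iUnion, Set.mem_ofPred_eq, Subtype.exists, exists_prop]
    constructor
    · intro hx
      by_contra! h
      exact hx (hC x h)
    · rintro ⟨F, hF, hx⟩ hxC
      exact hx (hF x hxC)
  rw [this]
  exact isOpen_iUnion fun F => TopologicalSpace.isOpen_generateFrom_of_mem ⟨F.1, rfl⟩

open Classical in
/-- Multiplication of the coordinates in `s` by `t`. -/
noncomputable def scaleOn (s : Finset ρ) (t : k) (y : ρ → k) : ρ → k :=
  fun i => if i ∈ s then t * y i else y i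

/-- The weight that counts the degree in the variables indexed by `s`. -/
noncomputable def blockWeight (s : Finset ρ) : ρ → ℕ := (s : Set ρ).indicator 1

theorem blockWeight_of_mem {s : Finset ρ} {i : ρ} (h : i ∈ s) : blockWeight s i = 1 := by
  simp [blockWeight, h]

theorem blockWeight_of_notMem {s : Finset ρ} {i : ρ} (h : i ∉ s) : blockWeight s i = 0 := by
  simp [blockWeight, h]

/-- Restriction of a polynomial to the curve `t ↦ scaleOn s t y`. -/
noncomputable def restrictToScaling (s : Finset ρ) (y : ρ → k) :
    MvPolynomial ρ k →ₐ[k] Polynomial k :=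
  aeval fun i => Polynomial.C (y i) * Polynomial.X ^ blockWeight s i

theorem eval_restrictToScaling (s : Finset ρ) (y : ρ → k) (t : k) (f : MvPolynomial ρ k) :
    (restrictToScaling s y f).eval t = eval (scaleOn s t y) f := by
  have : (Polynomial.aeval t).comp (restrictToScaling s y) =
      (aeval (scaleOn s t y) : MvPolynomial ρ k →ₐ[k] k) := by
    ext i
    by_cases h : i ∈ s <;>
      simp [restrictToScaling, scaleOn, h, blockWeight_of_mem, blockWeight_of_notMem, mul_comm t]
  simpa [aeval_eq_eval, Polynomial.aeval_def] using DFunLike.congr_fun this f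

theorem coeff_restrictToScaling (s : Finset ρ) (y : ρ → k) (f : MvPolynomial ρ k) (n : ℕ) :
    (restrictToScaling s y f).coeff n =
      eval y (weightedHomogeneousComponent (blockWeight s) n f) := by
  induction f using MvPolynomial.induction_on' with
  | add a b ha hb => simp [ha, hb]
  | monomial m a =>
    have h1 : restrictToScaling s y (monomial m a) =
        Polynomial.C (a * m.prod fun i e => y i ^ e) *
          Polynomial.X ^ (Finsupp.weight (blockWeight s) m) := by
      rw [restrictToScaling, aeval_monomial]
      simp only [mul_pow, Finsupp.prod_mul, Polynomial.algebraMap_eq, map_mul, mul_assoc]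
      congr 2
      · simp [Finsupp.prod]
      · simp [Finsupp.prod, Finsupp.weight_apply, Finsupp.sum, ← pow_mul,
          Finset.prod_pow_eq_pow_sum, mul_comm]
    rw [h1, Polynomial.coeff_C_mul, Polynomial.coeff_X_pow,
      weightedHomogeneousComponent_of_mem (isWeightedHomogeneous_monomial _ m a rfl)]
    by_cases h : n = Finsupp.weight (blockWeight s) m
    · simp [h, eval_monomial]
    · simp [h]

theorem weightedHomogeneousComponent_mul_of_weight_zero (w : ρ → ℕ) {q : MvPolynomial ρ k}
    (hq : IsWeightedHomogeneous w q 0) (r : MvPolynomial ρ k) (n : ℕ) :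
    weightedHomogeneousComponent w n (r * q) = weightedHomogeneousComponent w n r * q := by
  let _ := weightedGradedAlgebra k w
  have e (f : MvPolynomial ρ k) (i : ℕ) :
      (DirectSum.decompose (weightedHomogeneousSubmodule k w) f i : MvPolynomial ρ k) =
        weightedHomogeneousComponent w i f := weightedDecomposition.decompose'_apply k w f i
  rw [← e, ← e]
  exact DirectSum.coe_decompose_mul_of_right_mem_zero (weightedHomogeneousSubmodule k w)
    ((mem_weightedHomogeneousSubmodule k w _ q).2 hq)

theorem weightedHomogeneousComponent_mul_of_mem (w : ρ → ℕ) {q : MvPolynomial ρ k} {m : ℕ}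
    (hq : IsWeightedHomogeneous w q m) (r : MvPolynomial ρ k) (n : ℕ) :
    weightedHomogeneousComponent w (n + m) (r * q) = weightedHomogeneousComponent w n r * q := by
  let _ := weightedGradedAlgebra k w
  have e (f : MvPolynomial ρ k) (i : ℕ) :
      (DirectSum.decompose (weightedHomogeneousSubmodule k w) f i : MvPolynomial ρ k) =
        weightedHomogeneousComponent w i f := weightedDecomposition.decompose'_apply k w f i
  rw [← e, ← e]
  exact DirectSum.coe_decompose_mul_add_of_right_mem (weightedHomogeneousSubmodule k w)
    ((mem_weightedHomogeneousSubmodule k w _ q).2 hq)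

/-- The ideal generated by the variables in `s`. -/
noncomputable def blockIdeal (k : Type*) [Field k] (s : Finset ρ) : Ideal (MvPolynomial ρ k) :=
  Ideal.span (X '' (s : Set ρ))

theorem mem_blockIdeal_pow {s : Finset ρ} {n : ℕ} {f : MvPolynomial ρ k}
    (hf : IsWeightedHomogeneous (blockWeight s) f n) : f ∈ blockIdeal k s ^ n := by
  rw [f.as_sum]
  refine Ideal.sum_mem _ fun m hm => ?_
  have hw := hf (mem_support_iff.1 hm)
  rw [monomial_eq, ← hw, Finsupp.weight_apply, Finsupp.sum, ← Finset.prod_pow_eq_pow_sum]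
  refine Ideal.mul_mem_left _ _ (Ideal.prod_mem_prod fun i _ => ?_)
  by_cases h : i ∈ s
  · rw [blockWeight_of_mem h, smul_eq_mul, mul_one]
    exact Ideal.pow_mem_pow (Ideal.subset_span (Set.mem_image_of_mem X h)) _
  · simp [blockWeight_of_notMem h]

theorem blockIdeal_pow_le (s : Finset ρ) (n : ℕ) :
    blockIdeal k s ^ n ≤ Ideal.span {f | IsWeightedHomogeneous (blockWeight s) f n} := by
  induction n with
  | zero =>
    refine le_top.trans ((Ideal.eq_top_iff_one _).2 ?_).ge
    exact Ideal.subset_span (isWeightedHomogeneous_one k _)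
  | succ n ih =>
    rw [pow_succ]
    refine (Ideal.mul_mono_left ih).trans ?_
    rw [blockIdeal, Ideal.span_mul_span']
    refine Ideal.span_mono ?_
    rintro _ ⟨f, hf, _, ⟨i, hi, rfl⟩, rfl⟩
    have := isWeightedHomogeneous_X k (blockWeight s) i
    rw [blockWeight_of_mem hi] at this
    exact IsWeightedHomogeneous.mul hf this

/-- The ideal of the polynomials whose restriction to the fibre over `x`, where the coordinates
outside `s` are those of `x`, vanishes. -/
noncomputable def fibreIdeal (s : Finset ρ) (x : ρ → k) : Ideal (MvPolynomial ρ k) :=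
  Ideal.span ((fun i => X i - C (x i)) '' (s : Set ρ)ᶜ)

theorem weightedHomogeneousComponent_mem_mul {s : Finset ρ} {x : ρ → k} {f : MvPolynomial ρ k}
    (hf : f ∈ fibreIdeal s x) (n : ℕ) :
    weightedHomogeneousComponent (blockWeight s) n f ∈ fibreIdeal s x * blockIdeal k s ^ n := by
  suffices h : ∀ r, weightedHomogeneousComponent (blockWeight s) n (r * f) ∈
      fibreIdeal s x * blockIdeal k s ^ n by simpa using h 1
  induction hf using Submodule.span_induction with
  | mem f hf =>
    intro r
    obtain ⟨i, hi, rfl⟩ := hf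
    have h0 : IsWeightedHomogeneous (blockWeight s) (X i - C (x i)) 0 := by
      refine IsWeightedHomogeneous.sub ?_ (isWeightedHomogeneous_C _ _)
      have := isWeightedHomogeneous_X k (blockWeight s) i
      rwa [blockWeight_of_notMem hi] at this
    rw [weightedHomogeneousComponent_mul_of_weight_zero _ h0 r n,
      mul_comm (weightedHomogeneousComponent _ _ _)]
    exact Ideal.mul_mem_mul (Ideal.subset_span (Set.mem_image_of_mem _ hi))
      (mem_blockIdeal_pow (weightedHomogeneousComponent_isWeightedHomogeneous n r))
  | zero => simp
  | add a b _ _ ha hb => intro r; rw [mul_add, map_add]; exact add_mem (ha r) (hb r)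
  | smul r' a _ ha => intro r; rw [smul_eq_mul, ← mul_assoc]; exact ha _

theorem eval_eq_of_weight_zero {s : Finset ρ} {f : MvPolynomial ρ k}
    (hf : IsWeightedHomogeneous (blockWeight s) f 0) {x y : ρ → k} (h : ∀ i ∉ s, y i = x i) :
    eval y f = eval x f := by
  rw [eval_eq, eval_eq]
  refine Finset.sum_congr rfl fun m hm => ?_
  congr 1
  refine Finset.prod_congr rfl fun i hi => ?_
  rw [h i]
  intro his
  have hw := hf (mem_support_iff.1 hm)
  rw [Finsupp.weight_apply, Finsupp.sum, Finset.sum_eq_zero_iff] at hw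
  have := hw i hi
  rw [blockWeight_of_mem his] at this
  exact (Finsupp.mem_support_iff.1 hi) (by simpa using this)

/-- The cylinder over the projection of `C` along the coordinates in `s`, where only the points of
`C` whose coordinates in `s` are not all zero are projected. -/
def eliminate (s : Finset ρ) (C : Set (ρ → k)) : Set (ρ → k) :=
  {x | ∃ y ∈ C, (∀ i ∉ s, y i = x i) ∧ ∃ i ∈ s, y i ≠ 0}

theorem blockIdeal_le_radical [IsAlgClosed k] (s : Finset ρ) {C : Set (ρ → k)}
    (hC : IsZeroLocus C) {x : ρ → k} (hx : x ∉ eliminate s C) :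
    blockIdeal k s ≤ (MvPolynomial.vanishingIdeal k C ⊔ fibreIdeal s x).radical := by
  classical
  -- Restriction to the fibre over `x`, a polynomial ring in the finitely many variables in `s`.
  let φ : MvPolynomial ρ k →ₐ[k] MvPolynomial s k :=
    aeval fun i => if h : i ∈ s then X ⟨i, h⟩ else MvPolynomial.C (x i)
  have hφX (j : s) : φ (X j.1) = X j := by simp [φ]
  have hφ : Function.Surjective φ := by
    have : φ.comp (rename Subtype.val) = AlgHom.id k _ := by ext j; simp [φ]
    exact fun f => ⟨rename Subtype.val f, DFunLike.congr_fun this f⟩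
  have hker : ∀ f, f - rename Subtype.val (φ f) ∈ fibreIdeal s x := by
    intro f
    induction f using MvPolynomial.induction_on with
    | C a => simp [φ]
    | add p q hp hq =>
      rw [map_add, map_add, add_sub_add_comm]
      exact add_mem hp hq
    | mul_X p i hp =>
      have hXi : (X i : MvPolynomial ρ k) - rename Subtype.val (φ (X i)) ∈ fibreIdeal s x := by
        by_cases h : i ∈ s
        · simp [φ, h]
        · simp only [φ, aeval_X, h, ↓reduceDIte, rename_C]
          exact Ideal.subset_span (Set.mem_image_of_mem _ h)
      rw [map_mul, map_mul]
      convert add_mem (Ideal.mul_mem_right (X i) _ hp)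
        (Ideal.mul_mem_left _ (rename Subtype.val (φ p)) hXi) using 1
      ring
  have hzero : ∀ y ∈ zeroLocus k ((MvPolynomial.vanishingIdeal k C).map φ), ∀ j, y j = 0 := by
    intro y hy j
    by_contra hj
    let y' : ρ → k := fun i => if h : i ∈ s then y ⟨i, h⟩ else x i
    have hy' : (aeval y).comp φ = (aeval y' : MvPolynomial ρ k →ₐ[k] k) := by
      ext i
      by_cases h : i ∈ s <;> simp [φ, y', h]
    refine hx ⟨y', hC _ fun F hF => ?_, fun i hi => by simp [y', hi], j.1, j.2, by simpa [y']⟩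
    have := hy (φ F) (Ideal.mem_map_of_mem φ fun z hz => by rw [aeval_eq_eval]; exact hF z hz)
    have h2 := DFunLike.congr_fun hy' F
    rw [aeval_eq_eval y'] at h2
    exact h2.symm.trans this
  rw [blockIdeal, Ideal.span_le]
  rintro _ ⟨j, hj, rfl⟩
  have hrad : (X ⟨j, hj⟩ : MvPolynomial s k) ∈
      ((MvPolynomial.vanishingIdeal k C).map φ).radical := by
    rw [← vanishingIdeal_zeroLocus_eq_radical (K := k)]
    intro y hy
    simpa using hzero y hy ⟨j, hj⟩
  obtain ⟨N, hN⟩ := hrad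
  obtain ⟨P, hP, hPN⟩ := (Ideal.mem_map_iff_of_surjective φ hφ).1 hN
  refine ⟨N, ?_⟩
  have h1 : (X j : MvPolynomial ρ k) ^ N - P ∈ fibreIdeal s x := by
    have := sub_mem (hker (X j ^ N)) (hker P)
    rw [hPN, map_pow, hφX ⟨j, hj⟩] at this
    simpa using this
  have h2 := add_mem (Ideal.mem_sup_left (T := fibreIdeal s x) hP)
    (Ideal.mem_sup_right (S := MvPolynomial.vanishingIdeal k C) h1)
  simpa using h2

/-- The main theorem of elimination theory: the projection of a closed set that is a cone in the
coordinates in `s`, with the vertex removed, is closed. Over a point outside of the projection some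
power of the ideal of the variables in `s` lies in the ideal of the fibre by the Nullstellensatz,
and Nakayama's lemma extends this to a neighbourhood. -/
theorem IsZeroLocus.eliminate [IsAlgClosed k] (s : Finset ρ) {C : Set (ρ → k)}
    (hC : IsZeroLocus C) (hscale : ∀ y ∈ C, ∀ t, scaleOn s t y ∈ C) :
    IsZeroLocus (eliminate s C) := by
  have : Infinite k := IsAlgClosed.instInfinite
  intro x hF
  by_contra hx
  set I := MvPolynomial.vanishingIdeal k C
  set w := blockWeight s
  have hmemI (f : MvPolynomial ρ k) : f ∈ I ↔ ∀ y ∈ C, eval y f = 0 := by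
    simp [I, aeval_eq_eval]
  have hI : ∀ f ∈ I, ∀ n, weightedHomogeneousComponent w n f ∈ I := by
    intro f hf n
    rw [hmemI] at hf ⊢
    intro y hy
    have : restrictToScaling s y f = 0 := by
      refine Polynomial.funext fun t => ?_
      rw [eval_restrictToScaling, Polynomial.eval_zero]
      exact hf _ (hscale y hy t)
    rw [← coeff_restrictToScaling, this, Polynomial.coeff_zero]
  have hfg : (blockIdeal k s).FG := Submodule.fg_span (s.finite_toSet.image _)
  obtain ⟨n, hn⟩ := Ideal.exists_pow_le_of_le_radical_of_fg (blockIdeal_le_radical s hC hx) hfg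
  have hle : blockIdeal k s ^ n ≤ I ⊔ fibreIdeal s x • blockIdeal k s ^ n := by
    refine (blockIdeal_pow_le s n).trans (Ideal.span_le.2 fun f hf => ?_)
    obtain ⟨a, ha, b, hb, rfl⟩ := Submodule.mem_sup.1 (hn (mem_blockIdeal_pow hf))
    have h := IsWeightedHomogeneous.weightedHomogeneousComponent_same hf
    rw [← h, map_add]
    exact add_mem (Ideal.mem_sup_left (hI a ha n))
      (Ideal.mem_sup_right (weightedHomogeneousComponent_mem_mul hb n))
  obtain ⟨h, h1, h2⟩ := Submodule.exists_sub_one_mem_and_smul_le_of_fg_of_le_sup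
    (Ideal.FG.pow hfg) le_rfl hle
  set h₀ := weightedHomogeneousComponent w 0 h
  have hw₀ : IsWeightedHomogeneous w h₀ 0 := weightedHomogeneousComponent_isWeightedHomogeneous 0 h
  have hx₀ : eval x h₀ = 1 := by
    have h3 := Ideal.mul_le_left (weightedHomogeneousComponent_mem_mul h1 0)
    rw [map_sub, IsWeightedHomogeneous.weightedHomogeneousComponent_same
      (isWeightedHomogeneous_one k (blockWeight s))] at h3
    have h4 : fibreIdeal s x ≤ RingHom.ker (eval x) := by
      rw [fibreIdeal, Ideal.span_le]
      rintro _ ⟨i, -, rfl⟩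
      simp
    have h5 := h4 h3
    rw [RingHom.mem_ker, map_sub, map_one, sub_eq_zero] at h5
    exact h5
  refine one_ne_zero (hx₀.symm.trans (hF h₀ ?_))
  rintro x' ⟨y, hy, hyx, j, hj, hyj⟩
  rw [← eval_eq_of_weight_zero hw₀ hyx]
  have hXj : IsWeightedHomogeneous w ((X j : MvPolynomial ρ k) ^ n) n := by
    have := (isWeightedHomogeneous_X k w j).pow n
    rwa [show w j = 1 from blockWeight_of_mem hj, smul_eq_mul, mul_one] at this
  have hmem : h * X j ^ n ∈ I :=
    h2 (Submodule.smul_mem_pointwise_smul _ h _ (mem_blockIdeal_pow hXj))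
  have hcomp := hI _ hmem (0 + n)
  rw [weightedHomogeneousComponent_mul_of_mem w hXj] at hcomp
  have := (hmemI _).1 hcomp y hy
  rw [map_mul, map_pow, eval_X] at this
  exact (mul_eq_zero.1 this).resolve_right (pow_ne_zero n hyj)

/-- Elimination of several disjoint blocks of homogeneous coordinates: closed subsets of a product
with projective spaces have closed projections. -/
theorem IsZeroLocus.eliminate_blocks [IsAlgClosed k] {ι : Type*} (s : ι → Finset ρ)
    (hs : ∀ i j, i ≠ j → Disjoint (s i) (s j)) {C : Set (ρ → k)} (hC : IsZeroLocus C)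
    (hscale : ∀ i, ∀ y ∈ C, ∀ t, scaleOn (s i) t y ∈ C) (T : Finset ι) :
    IsZeroLocus {x : ρ → k | ∃ y ∈ C, (∀ r, (∀ i ∈ T, r ∉ s i) → y r = x r) ∧
      ∀ i ∈ T, ∃ r ∈ s i, y r ≠ 0} := by
  classical
  induction T using Finset.induction_on with
  | empty =>
    convert hC using 1
    ext x
    constructor
    · rintro ⟨y, hy, h, -⟩
      rwa [← show y = x from funext fun r => h r (by simp)]
    · exact fun hx => ⟨x, hx, by simp⟩
  | insert a T ha ih =>
    have hdisj : ∀ i ∈ T, Disjoint (s i) (s a) := fun i hi =>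
      hs i a (by rintro rfl; exact ha hi)
    convert ih.eliminate (s a) ?_ using 1
    · ext x
      constructor
      · rintro ⟨y, hy, h, hne⟩
        refine ⟨fun r => if r ∈ s a then y r else x r, ⟨y, hy, ?_, ?_⟩, ?_, ?_⟩
        · intro r hr
          by_cases hra : r ∈ s a
          · simp [hra]
          · simp only [hra, if_false]
            exact h r (by simpa [hra] using hr)
        · exact fun i hi => hne i (Finset.mem_insert_of_mem hi)
        · intro i hi; simp [hi]
        · obtain ⟨r, hr, hr'⟩ := hne a (Finset.mem_insert_self _ _)
          exact ⟨r, hr, by simpa [hr]⟩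
      · rintro ⟨z, ⟨y, hy, hyz, hne⟩, hzx, r, hr, hr'⟩
        refine ⟨y, hy, ?_, ?_⟩
        · intro r' hr'
          rw [hyz r' fun i hi => hr' i (Finset.mem_insert_of_mem hi),
            hzx r' (hr' a (Finset.mem_insert_self _ _))]
        · intro i hi
          rcases Finset.mem_insert.1 hi with rfl | hi
          · refine ⟨r, hr, ?_⟩
            rwa [hyz r fun j hj hrj => Finset.disjoint_left.1 (hdisj j hj) hrj hr]
          · exact hne i hi
    · rintro x ⟨y, hy, h, hne⟩ t
      refine ⟨scaleOn (s a) t y, hscale a y hy t, ?_, ?_⟩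
      · intro r hr
        simp only [scaleOn, h r hr]
      · intro i hi
        obtain ⟨r, hr, hr'⟩ := hne i hi
        refine ⟨r, hr, ?_⟩
        simpa [scaleOn, Finset.disjoint_left.1 (hdisj i hi) hr]

end Elimination

/-! ### Norms of linear forms and closed conditions on the Grassmannian -/

section LimitData

open MvPolynomial

variable {k : Type*} [Field k]

/-- Multiplication by a linear form, as a linear map from forms of degree `e` to forms of degree
`e + 1`. -/
noncomputable def mulForm (e : ℕ) (l : Form k 1) : Form k e →ₗ[k] Form k (e + 1) where
  toFun b := ⟨b.1 * l.1, IsHomogeneous.mul b.2 l.2⟩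
  map_add' b c := Subtype.ext (add_mul b.1 c.1 l.1)
  map_smul' t b := Subtype.ext (smul_mul_assoc t b.1 l.1)

theorem coe_mulForm (e : ℕ) (l : Form k 1) (b : Form k e) :
    (mulForm e l b : Coord k) = b.1 * l.1 := rfl

/-- The determinant of the matrix with columns `A (b j * l)`. When `A` is the quotient map from
forms of degree `e + 1` to the homogeneous coordinate ring of a subscheme of length `n`, this is,
up to a factor that depends on the forms `b j`, the norm of the linear form `l` on the subscheme. -/
noncomputable def normForm {n e : ℕ} (A : Form k (e + 1) → Fin n → k) (b : Fin n → Form k e)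
    (l : Form k 1) : k :=
  (Matrix.of fun i j => A (mulForm e l (b j)) i).det

/-- The bihomogeneous equations that relate a matrix `g`, vectors `w i`, and a linear map `A` on
forms of degree `e + 1` whenever `w i` is proportional to `g (z i)` and the kernel of `A` is the
space of forms vanishing at all `w i`. They say that `w i` and `g (z i)` are proportional, and that
the norm is proportional to the product of the values at the points `w i`. -/
def IsLimitDatum {n e : ℕ} (z : Fin n → Fin 3 → k) (A : Form k (e + 1) → Fin n → k)
    (g : Matrix (Fin 3) (Fin 3) k) (w : Fin n → Fin 3 → k) : Prop :=
  (∀ i p q, w i p * g.mulVec (z i) q = w i q * g.mulVec (z i) p) ∧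
  ∀ b l l', normForm A b l * ∏ i, eval (w i) l'.1 = normForm A b l' * ∏ i, eval (w i) l.1

/-- There is a point `(g, w)` of the product of the projective space of `3 × 3` matrices and of `n`
projective planes that satisfies the equations of `IsLimitDatum` with `A`. -/
def HasLimitDatum {n e : ℕ} (z : Fin n → Fin 3 → k) (A : Form k (e + 1) → Fin n → k) : Prop :=
  ∃ g w, g ≠ 0 ∧ (∀ i, w i ≠ 0) ∧ IsLimitDatum z A g w

theorem exists_comp_eq_of_ker_le {V V₁ V₂ : Type*} [AddCommGroup V] [Module k V]
    [AddCommGroup V₁] [Module k V₁] [AddCommGroup V₂] [Module k V₂] (f : V →ₗ[k] V₁)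
    (g : V →ₗ[k] V₂) (h : LinearMap.ker f ≤ LinearMap.ker g) : ∃ M : V₁ →ₗ[k] V₂, M ∘ₗ f = g := by
  obtain ⟨s, hs⟩ := ((LinearMap.ker f).liftQ f le_rfl).exists_leftInverse_of_injective
    (Submodule.ker_liftQ_eq_bot _ _ _ le_rfl)
  refine ⟨(LinearMap.ker f).liftQ g h ∘ₗ s, LinearMap.ext fun x => ?_⟩
  have := DFunLike.congr_fun hs (Submodule.Quotient.mk x)
  rw [LinearMap.comp_apply, Submodule.liftQ_apply] at this
  simp [this]

theorem normForm_comp {n e : ℕ} (A : Form k (e + 1) → Fin n → k)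
    (M : (Fin n → k) →ₗ[k] (Fin n → k)) (b : Fin n → Form k e) (l : Form k 1) :
    normForm (fun v => M (A v)) b l = LinearMap.det M * normForm A b l := by
  rw [normForm, normForm, ← LinearMap.det_toMatrix', ← Matrix.det_mul]
  congr 1
  ext i j
  rw [Matrix.of_apply, Matrix.mul_apply, ← LinearMap.toMatrix'_mulVec M]
  rfl

theorem IsLimitDatum.comp {n e : ℕ} {z : Fin n → Fin 3 → k} {A : Form k (e + 1) → Fin n → k}
    {g : Matrix (Fin 3) (Fin 3) k} {w : Fin n → Fin 3 → k} (h : IsLimitDatum z A g w)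
    (M : (Fin n → k) →ₗ[k] (Fin n → k)) : IsLimitDatum z (fun v => M (A v)) g w := by
  refine ⟨h.1, fun b l l' => ?_⟩
  rw [normForm_comp, normForm_comp, mul_assoc, mul_assoc, h.2]

/-- Evaluation of forms of degree `d` at finitely many vectors. -/
noncomputable def evalForms {n : ℕ} (d : ℕ) (w : Fin n → Fin 3 → k) :
    Form k d →ₗ[k] (Fin n → k) where
  toFun f i := eval (w i) f.1
  map_add' f g := by ext i; simp
  map_smul' c f := by ext i; simp

theorem normForm_evalForms {n e : ℕ} (w : Fin n → Fin 3 → k) (b : Fin n → Form k e)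
    (l : Form k 1) :
    normForm (evalForms (e + 1) w) b l =
      (∏ i, eval (w i) l.1) * (Matrix.of fun i j => eval (w i) (b j).1).det := by
  rw [← Matrix.det_mul_column, normForm]
  congr 1
  ext i j
  simp [evalForms, coe_mulForm, mul_comm]

theorem isLimitDatum_of_ker_eq {n e : ℕ} (z : Fin n → Fin 3 → k)
    (A : Form k (e + 1) →ₗ[k] (Fin n → k)) (g : Matrix (Fin 3) (Fin 3) k)
    (hA : LinearMap.ker (evalForms (e + 1) fun i => g.mulVec (z i)) ≤ LinearMap.ker A) :
    IsLimitDatum z A g fun i => g.mulVec (z i) := by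
  obtain ⟨M, rfl⟩ := exists_comp_eq_of_ker_le _ _ hA
  refine IsLimitDatum.comp ⟨fun i p q => mul_comm _ _, fun b l l' => ?_⟩ M
  rw [normForm_evalForms, normForm_evalForms]
  ring

theorem eval_smul_of_mem_form {d : ℕ} {f : Coord k} (hf : f ∈ Form k d) (c : k)
    (v : Fin 3 → k) : eval (c • v) f = c ^ d * eval v f := by
  rw [eval_eq, eval_eq, Finset.mul_sum]
  refine Finset.sum_congr rfl fun m hm => ?_
  have hdeg : ∑ i ∈ m.support, m i = d := by
    rw [← Finsupp.degree_apply, Finsupp.degree_eq_weight_one]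
    exact hf (mem_support_iff.1 hm)
  simp_rw [Pi.smul_apply, smul_eq_mul, mul_pow, Finset.prod_mul_distrib,
    Finset.prod_pow_eq_pow_sum, hdeg]
  ring

theorem IsZeroLocus.inter {ρ : Type*} {C D : Set (ρ → k)} (hC : IsZeroLocus C)
    (hD : IsZeroLocus D) : IsZeroLocus (C ∩ D) := fun x hx =>
  ⟨hC x fun F hF => hx F fun y hy => hF y hy.1, hD x fun F hF => hx F fun y hy => hF y hy.2⟩

theorem IsZeroLocus.preimage {ρ σ : Type*} {C : Set (ρ → k)} (hC : IsZeroLocus C)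
    (φ : MvPolynomial ρ k →ₐ[k] MvPolynomial σ k) :
    IsZeroLocus {a : σ → k | (fun r => eval a (φ (X r))) ∈ C} := by
  have h (a : σ → k) (F : MvPolynomial ρ k) :
      eval (fun r => eval a (φ (X r))) F = eval a (φ F) := by
    have : (aeval fun r => eval a (φ (X r)) : MvPolynomial ρ k →ₐ[k] k) =
        (aeval a : MvPolynomial σ k →ₐ[k] k).comp φ := by
      ext r; simp [aeval_eq_eval]
    simpa [aeval_eq_eval] using DFunLike.congr_fun this F
  intro x hx
  refine hC _ fun F hF => ?_
  rw [h]
  exact hx _ fun y hy => by rw [← h]; exact hF _ hy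

/-- Coordinates for triples consisting of a function `A` on forms with values in `kⁿ`, a `3 × 3`
matrix `g` and `n` vectors `w i`. -/
abbrev DatumIndex (k : Type*) [Field k] (n e : ℕ) : Type _ :=
  (Form k (e + 1) × Fin n) ⊕ (Fin 3 × Fin 3) ⊕ (Fin n × Fin 3)

namespace DatumIndex

variable {n e : ℕ}

/-- The function on forms with the given coordinates. -/
def map (y : DatumIndex k n e → k) : Form k (e + 1) → Fin n → k := fun v i => y (.inl (v, i))

/-- The matrix with the given coordinates. -/
def matrix (y : DatumIndex k n e → k) : Matrix (Fin 3) (Fin 3) k :=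
  .of fun p q => y (.inr (.inl (p, q)))

/-- The vectors with the given coordinates. -/
def point (y : DatumIndex k n e → k) : Fin n → Fin 3 → k := fun i p => y (.inr (.inr (i, p)))

open Classical in
/-- The blocks of homogeneous coordinates: the entries of the matrix, and the entries of each of
the vectors. -/
noncomputable def block : Option (Fin n) → Finset (DatumIndex k n e)
  | none => Finset.univ.image fun pq => .inr (.inl pq)
  | some i => Finset.univ.image fun p => .inr (.inr (i, p))

theorem disjoint_block (i j : Option (Fin n)) (h : i ≠ j) :
    Disjoint (block i : Finset (DatumIndex k n e)) (block j) := by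
  rw [Finset.disjoint_left]
  rcases i with _ | i <;> rcases j with _ | j <;> simp_all [block]
  grind

theorem isZeroLocus_isLimitDatum (z : Fin n → Fin 3 → k) :
    IsZeroLocus {y : DatumIndex k n e → k | IsLimitDatum z (map y) (matrix y) (point y)} := by
  let G (q : Fin 3) (i : Fin n) : MvPolynomial (DatumIndex k n e) k :=
    ∑ r, X (.inr (.inl (q, r))) * C (z i r)
  let P (i : Fin n) (l : Form k 1) : MvPolynomial (DatumIndex k n e) k :=
    aeval (fun p => X (.inr (.inr (i, p)))) l.1
  let N (b : Fin n → Form k e) (l : Form k 1) : MvPolynomial (DatumIndex k n e) k :=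
    (Matrix.of fun i j => X (.inl (mulForm e l (b j), i))).det
  have hG (y : DatumIndex k n e → k) (q i) : eval y (G q i) = (matrix y).mulVec (z i) q := by
    simp [G, Matrix.mulVec, dotProduct, matrix]
  have hP (y : DatumIndex k n e → k) (i l) : eval y (P i l) = eval (point y i) l.1 := by
    have : (aeval y).comp (aeval fun p => X (.inr (.inr (i, p)) : DatumIndex k n e)) =
        (aeval (point y i) : MvPolynomial (Fin 3) k →ₐ[k] k) := by
      ext p; simp [point]
    have h := DFunLike.congr_fun this l.1
    rwa [AlgHom.comp_apply, aeval_eq_eval, aeval_eq_eval] at h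
  have hN (y : DatumIndex k n e → k) (b l) : eval y (N b l) = normForm (map y) b l := by
    rw [normForm, RingHom.map_det]
    congr 1
    ext i j
    simp [map]
  have h1 := isZeroLocus_setOf_eval_eq_zero (k := k) fun t : Fin n × Fin 3 × Fin 3 =>
    (X (.inr (.inr (t.1, t.2.1))) * G t.2.2 t.1 - X (.inr (.inr (t.1, t.2.2))) * G t.2.1 t.1 :
      MvPolynomial (DatumIndex k n e) k)
  have h2 := isZeroLocus_setOf_eval_eq_zero (k := k)
    fun t : (Fin n → Form k e) × Form k 1 × Form k 1 =>
      N t.1 t.2.1 * ∏ i, P i t.2.2 - N t.1 t.2.2 * ∏ i, P i t.2.1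
  convert h1.inter h2 using 1
  ext y
  simp [IsLimitDatum, hG, hP, hN, sub_eq_zero, point]

theorem isLimitDatum_scaleOn {z : Fin n → Fin 3 → k} {y : DatumIndex k n e → k}
    (h : IsLimitDatum z (map y) (matrix y) (point y)) (i : Option (Fin n)) (t : k) :
    IsLimitDatum z (map (scaleOn (block i) t y)) (matrix (scaleOn (block i) t y))
      (point (scaleOn (block i) t y)) := by
  have hmap : map (scaleOn (block i) t y) = map y := by
    ext v j
    rcases i with _ | i <;> simp [map, scaleOn, block]
  rw [hmap]
  rcases i with _ | i
  · have hg : matrix (scaleOn (block none) t y) = t • matrix y := by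
      ext p q; simp [matrix, scaleOn, block]
    have hw : point (scaleOn (block none) t y) = point y := by
      ext p q; simp [point, scaleOn, block]
    rw [hg, hw]
    refine ⟨fun i p q => ?_, h.2⟩
    have := h.1 i p q
    simp only [Matrix.smul_mulVec, Pi.smul_apply, smul_eq_mul]
    linear_combination t * this
  · have hg : matrix (scaleOn (block (some i)) t y) = matrix y := by
      ext p q; simp [matrix, scaleOn, block]
    have hwi : point (scaleOn (block (some i)) t y) i = t • point y i := by
      ext p; simp [point, scaleOn, block]
    have hw (j) (hj : j ≠ i) : point (scaleOn (block (some i)) t y) j = point y j := by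
      ext p; simp [point, scaleOn, block, hj.symm]
    have hprod (l : Form k 1) : ∏ j, eval (point (scaleOn (block (some i)) t y) j) l.1 =
        t * ∏ j, eval (point y j) l.1 := by
      rw [← Finset.mul_prod_erase _ _ (Finset.mem_univ i), hwi,
        eval_smul_of_mem_form l.2, pow_one,
        ← Finset.mul_prod_erase _ (fun j => eval (point y j) l.1) (Finset.mem_univ i), mul_assoc]
      congr 2
      exact Finset.prod_congr rfl fun j hj => by rw [hw j (Finset.ne_of_mem_erase hj)]
    rw [hg]
    refine ⟨fun j p q => ?_, fun b l l' => ?_⟩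
    · have := h.1 j p q
      by_cases hj : j = i
      · subst hj
        simp only [hwi, Pi.smul_apply, smul_eq_mul]
        linear_combination t * this
      · rwa [hw j hj]
    · rw [hprod, hprod]
      linear_combination t * h.2 b l l'

end DatumIndex

open DatumIndex Classical in
theorem isZeroLocus_hasLimitDatum [IsAlgClosed k] {n e : ℕ} (z : Fin n → Fin 3 → k) :
    IsZeroLocus {a : Form k (e + 1) × Fin n → k | HasLimitDatum z fun v i => a (v, i)} := by
  have h := ((isZeroLocus_isLimitDatum (e := e) z).eliminate_blocks block disjoint_block
    (fun i y hy t => isLimitDatum_scaleOn hy i t) Finset.univ).preimage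
    (aeval (Sum.elim X fun _ => 0) : _ →ₐ[k] MvPolynomial (Form k (e + 1) × Fin n) k)
  convert h using 1
  ext a
  constructor
  · rintro ⟨g, w, hg, hw, hd⟩
    refine ⟨Sum.elim a (Sum.elim (fun pq => g pq.1 pq.2) fun ip => w ip.1 ip.2), hd, ?_, ?_⟩
    · rintro (v | pq | ⟨i, p⟩) hr
      · simp
      · exact absurd (by simp [block]) (hr none (Finset.mem_univ _))
      · exact absurd (by simp [block]) (hr (some i) (Finset.mem_univ _))
    · rintro (_ | i) -
      · obtain ⟨p, hp⟩ := Function.ne_iff.1 hg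
        obtain ⟨q, hq⟩ := Function.ne_iff.1 hp
        exact ⟨.inr (.inl (p, q)), by simp [block], hq⟩
      · obtain ⟨p, hp⟩ := Function.ne_iff.1 (hw i)
        exact ⟨.inr (.inr (i, p)), by simp [block], hp⟩
  · rintro ⟨y, hy, hyx, hne⟩
    refine ⟨matrix y, point y, fun h0 => ?_, fun i h0 => ?_, ?_⟩
    · obtain ⟨r, hr, hr'⟩ := hne none (Finset.mem_univ _)
      obtain ⟨⟨p, q⟩, -, rfl⟩ := Finset.mem_image.1 hr
      exact hr' (congr_fun (congr_fun h0 p) q)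
    · obtain ⟨r, hr, hr'⟩ := hne (some i) (Finset.mem_univ _)
      obtain ⟨p, -, rfl⟩ := Finset.mem_image.1 hr
      exact hr' (congr_fun h0 p)
    · convert (show IsLimitDatum z (map y) (matrix y) (point y) from hy) using 1
      ext v i
      have := hyx (.inl (v, i)) (by rintro (_ | j) - <;> simp [block])
      exact (by simpa using this.symm : a (v, i) = y (.inl (v, i)))

/-- The subspaces of codimension `n` whose quotient maps have a limit datum, together with all
subspaces of other codimensions, form a closed subset of the Grassmannian. -/
theorem isClosed_hasLimitDatum [IsAlgClosed k] {n e : ℕ} (z : Fin n → Fin 3 → k) :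
    @IsClosed _ (grassmannianTopology k (Form k (e + 1)))
      {U | ∀ A : Frame k (Form k (e + 1)) n, LinearMap.ker A.1 = U → HasLimitDatum z A.1} := by
  rw [grassmannianTopology, isClosed_iSup_iff]
  intro m
  rw [isClosed_coinduced]
  by_cases hm : m = n
  · subst hm
    let _ := zariskiTopology (Form k (e + 1) × Fin m) k
    rw [frameTopology, isClosed_induced_iff]
    refine ⟨_, (isZeroLocus_hasLimitDatum (e := e) z).isClosed, ?_⟩
    ext A
    constructor
    · rintro ⟨g, w, hg, hw, hd⟩ A' hA'
      obtain ⟨M, hM⟩ := exists_comp_eq_of_ker_le A.1 A'.1 hA'.ge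
      refine ⟨g, w, hg, hw, ?_⟩
      rw [← hM]
      exact hd.comp M
    · exact fun h => h A rfl
  · convert! isClosed_univ
    ext A
    simp only [Set.mem_preimage, Set.mem_univ, iff_true]
    intro A' hA'
    refine absurd ?_ hm
    have h1 := (A.1.quotKerEquivOfSurjective A.2).finrank_eq
    have h2 := (A'.1.quotKerEquivOfSurjective A'.2).finrank_eq
    rw [hA', h1] at h2
    simpa using h2

theorem mem_pointIdeal_mk {d : ℕ} {f : Coord k} (hf : f ∈ Form k d) {v : Fin 3 → k} (hv : v ≠ 0) :
    f ∈ pointIdeal (.mk k v hv) ↔ eval v f = 0 := by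
  rw [mem_pointIdeal_of_form _ hf]
  obtain ⟨c, hc⟩ := Projectivization.exists_smul_eq_mk_rep k v hv
  rw [← hc]
  rw [Units.smul_def, eval_smul_of_mem_form hf, mul_eq_zero,
    or_iff_right (pow_ne_zero _ c.ne_zero)]

/-- Every point of the closure of the orbit of `Z` has a limit datum in all large degrees. -/
theorem hasLimitDatum_of_mem_closure_orbit [IsAlgClosed k] {n e : ℕ} {Z : Finset (P2 k)}
    (hZ : Z.card = n) {z : Fin n → P2 k} (hz : Set.range z = Z) {W : Hilb k n}
    (hW : W ∈ closure (orbit Z hZ)) (he : n ≤ e + 1) (A : Frame k (Form k (e + 1)) n)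
    (hA : LinearMap.ker A.1 = degreePart W.ideal (e + 1)) :
    HasLimitDatum (fun i => (z i).rep) A.1 := by
  let S : Set (Submodule k (Form k (e + 1))) :=
    {U | ∀ A : Frame k (Form k (e + 1)) n, LinearMap.ker A.1 = U →
      HasLimitDatum (fun i => (z i).rep) A.1}
  have hclosed : IsClosed ((fun W : Hilb k n => degreePart W.ideal (e + 1)) ⁻¹' S) := by
    let _ := grassmannianTopology k (Form k (e + 1))
    refine IsClosed.preimage ?_ (isClosed_hasLimitDatum _)
    exact continuous_iInf_dom (i := ⟨e + 1, he⟩) continuous_induced_dom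
  refine closure_minimal ?_ hclosed hW A hA
  rintro _ ⟨g, rfl⟩ B hB
  obtain ⟨g, rfl⟩ := Matrix.ProjGenLinGroup.mk_surjective g
  have hne (i : Fin n) : g.1.mulVec (z i).rep ≠ 0 :=
    (smul_ne_zero_iff_ne g).2 (z i).rep_nonzero
  refine ⟨g.1, fun i => g.1.mulVec (z i).rep, ?_, hne, isLimitDatum_of_ker_eq _ _ _ ?_⟩
  · exact g.isUnit.ne_zero
  · rw [hB]
    intro f hf
    change f.1 ∈ vanishingIdeal _
    rw [mem_vanishingIdeal]
    intro p hp
    obtain ⟨q, hq, rfl⟩ := Finset.mem_map.1 hp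
    obtain ⟨i, rfl⟩ : q ∈ Set.range z := by rw [hz]; exact hq
    have : (MulAction.toPerm (Matrix.ProjGenLinGroup.mk g)).toEmbedding (z i) =
        .mk k (g.1.mulVec (z i).rep) (hne i) := by
      conv_lhs => rw [← (z i).mk_rep]
      rfl
    rw [this, mem_pointIdeal_mk f.2]
    exact congr_fun hf i

end LimitData

/-! ### Length and dimension -/

section Length

/-- Over a local ring `O` with coefficient field `k`, the length of a module is at least its
dimension over `k`; the dimension is tested on `k`-vector spaces `K` that embed in the module. -/
theorem finrank_le_length {k O : Type*} [Field k] [CommRing O] [IsLocalRing O] (φ : k →+* O)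
    (hφ : ∀ x : O, ∃ c, x - φ c ∈ IsLocalRing.maximalIdeal O) {K M : Type*} [AddCommGroup K]
    [Module k K] [Module.Finite k K] [AddCommGroup M] [Module O M] (ψ : K →ₛₗ[φ] M)
    (hψ : Function.Injective ψ) : (Module.finrank k K : ℕ∞) ≤ Module.length O M := by
  by_cases hM : Module.length O M = ⊤
  · rw [hM]; exact le_top
  rw [← ne_eq, Module.length_ne_top_iff] at hM
  induction hM generalizing K with
  | @of_subsingleton M _ _ _ =>
    have : Subsingleton K := hψ.subsingleton
    simp [Module.finrank_zero_of_subsingleton]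
  | @of_simple_quotient M _ _ N _ _ ih =>
    let K' : Submodule k K := LinearMap.ker (N.mkQ.comp ψ)
    have hK' : ∀ x : K', ψ x ∈ N := fun x => (Submodule.Quotient.mk_eq_zero N).1 x.2
    let ψ' : K' →ₛₗ[φ] N :=
      { toFun := fun x => ⟨ψ x, hK' x⟩
        map_add' := fun x y => Subtype.ext (map_add ψ x.1 y.1)
        map_smul' := fun c x => Subtype.ext (map_smulₛₗ ψ c x.1) }
    have h1 := ih ψ' fun x y h => Subtype.ext (hψ (congr_arg Subtype.val h))
    have h2 : Module.finrank k (K ⧸ K') ≤ 1 := by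
      by_cases htop : ∀ v, v ∈ K'
      · refine finrank_le_one 0 fun w => ⟨0, ?_⟩
        obtain ⟨w, rfl⟩ := K'.mkQ_surjective w
        rw [zero_smul, eq_comm]
        exact (Submodule.Quotient.mk_eq_zero K').2 (htop w)
      push Not at htop
      obtain ⟨v, hv⟩ := htop
      have hm : N.mkQ (ψ v) ≠ 0 := hv
      refine finrank_le_one (K'.mkQ v) fun w => ?_
      obtain ⟨w, rfl⟩ := K'.mkQ_surjective w
      obtain ⟨r, hr⟩ := IsSimpleModule.toSpanSingleton_surjective O hm (N.mkQ (ψ w))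
      obtain ⟨c, hc⟩ := hφ r
      refine ⟨c, ?_⟩
      have hann : (r - φ c) • N.mkQ (ψ v) = 0 := by
        by_contra h0
        obtain ⟨s, hs⟩ := IsSimpleModule.toSpanSingleton_surjective O h0 (N.mkQ (ψ v))
        rw [LinearMap.toSpanSingleton_apply, smul_smul] at hs
        have hu : IsUnit (1 - s * (r - φ c)) :=
          (IsLocalRing.isUnit_or_isUnit_one_sub_self _).resolve_left
            ((IsLocalRing.mem_maximalIdeal _).1 (Ideal.mul_mem_left _ s hc))
        refine hm ((hu.smul_eq_zero).1 ?_)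
        rw [sub_smul, one_smul, hs, sub_self]
      rw [← map_smul, ← sub_eq_zero, ← map_sub]
      refine (Submodule.Quotient.mk_eq_zero K').2 ?_
      change N.mkQ (ψ (c • v - w)) = 0
      rw [LinearMap.toSpanSingleton_apply] at hr
      rw [map_sub, map_smulₛₗ, map_sub, map_smul, ← hr, ← sub_smul, ← neg_sub, neg_smul, hann,
        neg_zero]
    rw [Module.length_eq_add_of_exact N.subtype N.mkQ N.subtype_injective N.mkQ_surjective
      (LinearMap.exact_subtype_mkQ N), Module.length_eq_one O (M ⧸ N),
      ← Submodule.finrank_quotient_add_finrank K', add_comm, Nat.cast_add]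
    exact add_le_add h1 (by exact_mod_cast h2)

end Length

/-! ### Linear forms in general position -/

section LinearForms

open MvPolynomial

variable {k : Type*} [Field k] [Infinite k] {ι : Type*} [Finite ι]

theorem exists_linear_form_ne_zero (q : ι → P2 k) :
    ∃ l ∈ Form k 1, ∀ i, eval (q i).rep l ≠ 0 := by
  obtain ⟨φ, hφ⟩ := Module.exists_dual_forall_apply_ne_zero (fun i => (q i).rep)
    (fun i => (q i).rep_nonzero) (K := k)
  obtain ⟨l, hl, h⟩ := exists_linear_form φ
  exact ⟨l, hl, fun i => by rw [h]; exact hφ i⟩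

theorem exists_linear_form_through (p : P2 k) (q : ι → P2 k) (hq : ∀ i, q i ≠ p) :
    ∃ l ∈ Form k 1, eval p.rep l = 0 ∧ ∀ i, eval (q i).rep l ≠ 0 := by
  let ev (p : P2 k) : Module.Dual k (Form k 1) :=
    { toFun := fun l => eval p.rep l.1
      map_add' := by simp
      map_smul' := by simp }
  obtain ⟨l, hl, h⟩ := Module.Dual.exists_forall_mem_ne_zero_of_forall_exists
    (LinearMap.ker (ev p)) (fun i => ev (q i)) fun i => by
      obtain ⟨l, hl, h1, h2⟩ := exists_separating_form (q i) p (hq i)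
      exact ⟨⟨l, hl⟩, h1, h2⟩
  exact ⟨l.1, l.2, hl, h⟩

end LinearForms

/-! ### Subschemes and their local rings -/

namespace Hilb

open MvPolynomial

variable {k : Type*} [Field k] {n : ℕ}

instance (d : ℕ) : Module.Finite k (Form k d) :=
  Module.Finite.iff_fg.2 (weightedHomogeneousSubmodule_fg k _ (fun _ => one_ne_zero) d)

theorem finite_support (W : Hilb k n) : W.support.Finite := by
  by_contra h
  obtain ⟨T, hT, hcard⟩ := Set.Infinite.exists_subset_card_eq h (n + 1)
  obtain ⟨d₀, hd₀⟩ := W.length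
  set d := max d₀ (n + 1)
  have h1 := hd₀ d (le_max_left _ _)
  have h2 := finrank_vanishingIdeal T d (hcard ▸ le_max_right _ _)
  have hle : degreePart W.ideal d ≤ degreePart (vanishingIdeal T) d := fun f hf =>
    (mem_vanishingIdeal T _).2 fun p hp => hT hp hf
  have := LinearMap.finrank_le_finrank_of_surjective (Submodule.factor_surjective hle)
  omega

theorem homogeneousComponent_mem (W : Hilb k n) {f : Coord k} (hf : f ∈ W.ideal) (d : ℕ) :
    homogeneousComponent d f ∈ W.ideal := by
  have := W.homogeneous d hf
  rwa [show (DirectSum.decompose (Form k) f d : Coord k) = homogeneousComponent d f from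
    decomposition.decompose'_apply f d] at this

theorem homogeneousComponent_mul {e : ℕ} {f : Coord k} (hf : f ∈ Form k e) (u : Coord k) (d : ℕ) :
    homogeneousComponent (d + e) (u * f) = homogeneousComponent d u * f := by
  have h (u : Coord k) (d : ℕ) : homogeneousComponent d u =
      (DirectSum.decompose (Form k) u d : Coord k) :=
    (decomposition.decompose'_apply u d).symm
  rw [h, h]
  exact DirectSum.coe_decompose_mul_add_of_right_mem (Form k) hf

theorem mem_of_irrelevant_pow_mul_mem (W : Hilb k n) (N : ℕ) {f : Coord k}
    (h : ∀ u ∈ Ideal.span (Set.range X) ^ N, u * f ∈ W.ideal) : f ∈ W.ideal := by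
  induction N generalizing f with
  | zero => simpa using h 1 (by simp)
  | succ N ih =>
    refine W.saturated f fun i => ih fun u hu => ?_
    rw [← mul_assoc]
    refine h _ ?_
    rw [pow_succ]
    exact Ideal.mul_mem_mul hu (Ideal.subset_span ⟨i, rfl⟩)

/-- A form that lies in the ideal of `W` locally at each point of the support lies in the ideal:
the homogeneous ideal of its multipliers has no zeros in the projective plane. -/
theorem mem_ideal_of_local [IsAlgClosed k] (W : Hilb k n) {e : ℕ} {f : Coord k}
    (hf : f ∈ Form k e) (h : ∀ p ∈ W.support, ∃ u ∉ pointIdeal p, u * f ∈ W.ideal) :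
    f ∈ W.ideal := by
  let J : Ideal (Coord k) :=
    Submodule.comap (LinearMap.toSpanSingleton (Coord k) (Coord k) f) W.ideal
  have hJ (u : Coord k) : u ∈ J ↔ u * f ∈ W.ideal := Iff.rfl
  have hzero : ∀ v ∈ zeroLocus k J, v = 0 := by
    intro v hv
    by_contra hv0
    obtain ⟨u, hu, huJ⟩ : ∃ u ∉ pointIdeal (.mk k v hv0), u ∈ J := by
      by_cases hp : .mk k v hv0 ∈ W.support
      · exact h _ hp
      · obtain ⟨u, hu, hup⟩ := SetLike.not_le_iff_exists.1 (show ¬W.ideal ≤ pointIdeal _ from hp)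
        exact ⟨u, hup, Ideal.mul_mem_right _ _ hu⟩
    rw [mem_pointIdeal] at hu
    push Not at hu
    obtain ⟨d, hd⟩ := hu
    rw [ne_eq, ← mem_pointIdeal_of_form _ (MvPolynomial.homogeneousComponent_mem d u),
      mem_pointIdeal_mk (MvPolynomial.homogeneousComponent_mem d u)] at hd
    have hdJ : homogeneousComponent d u ∈ J := by
      rw [hJ, ← homogeneousComponent_mul hf]
      exact W.homogeneousComponent_mem huJ _
    exact hd (by simpa [aeval_eq_eval] using hv _ hdJ)
  have hrad : Ideal.span (Set.range X) ≤ J.radical := by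
    rw [← vanishingIdeal_zeroLocus_eq_radical (K := k), Ideal.span_le]
    rintro _ ⟨i, rfl⟩ v hv
    simp [hzero v hv]
  obtain ⟨N, hN⟩ := Ideal.exists_pow_le_of_le_radical_of_fg hrad
    (Submodule.fg_span (Set.finite_range _))
  exact W.mem_of_irrelevant_pow_mul_mem N fun u hu => hN hu

theorem mem_ideal_of_mul_mem [IsAlgClosed k] (W : Hilb k n) {e : ℕ} {f l : Coord k}
    (hf : f ∈ Form k e) (hl : l ∈ Form k 1) (hne : ∀ p ∈ W.support, eval p.rep l ≠ 0)
    (h : f * l ∈ W.ideal) : f ∈ W.ideal :=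
  W.mem_ideal_of_local hf fun p hp =>
    ⟨l, by rw [mem_pointIdeal_of_form p hl]; exact hne p hp, by rwa [mul_comm]⟩

/-- The inclusion of the scalars in the local ring of the projective plane. -/
noncomputable def scalar (p : P2 k) : k →+* LocalRing p :=
  (algebraMap (Form k 0) (LocalRing p)).comp (algebraMap k (Form k 0))

theorem val_scalar (p : P2 k) (c : k) :
    (scalar p c).val = algebraMap (Coord k) (Localization.AtPrime (pointIdeal p)) (C c) := by
  rw [← Localization.mk_one_eq_algebraMap]
  rfl

theorem val_mk_eq {p : P2 k} (x : HomogeneousLocalization.NumDenSameDeg (Form k)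
    (pointIdeal p).primeCompl) :
    (HomogeneousLocalization.mk x).val =
      IsLocalization.mk' (Localization.AtPrime (pointIdeal p)) x.num.1 ⟨x.den.1, x.den_mem⟩ := by
  rw [HomogeneousLocalization.val_mk, Localization.mk_eq_mk']

/-- The residue field of the local ring at a closed point is the base field. -/
theorem exists_sub_scalar_mem (p : P2 k) (x : LocalRing p) :
    ∃ c, x - scalar p c ∈ IsLocalRing.maximalIdeal (LocalRing p) := by
  obtain ⟨⟨d, num, den, hden⟩, rfl⟩ := HomogeneousLocalization.mk_surjective x
  have hden' : eval p.rep den.1 ≠ 0 := fun h => hden ((mem_pointIdeal_of_form p den.2).2 h)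
  refine ⟨eval p.rep num.1 / eval p.rep den.1, ?_⟩
  set c := eval p.rep num.1 / eval p.rep den.1
  rw [IsLocalRing.mem_maximalIdeal, mem_nonunits_iff,
    ← HomogeneousLocalization.isUnit_iff_isUnit_val, HomogeneousLocalization.val_sub, val_scalar,
    val_mk_eq]
  have : IsLocalization.mk' (Localization.AtPrime (pointIdeal p)) num.1
      (⟨den.1, hden⟩ : (pointIdeal p).primeCompl) -
      algebraMap (Coord k) (Localization.AtPrime (pointIdeal p)) (C c) =
      IsLocalization.mk' (Localization.AtPrime (pointIdeal p)) (num.1 - C c * den.1)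
        (⟨den.1, hden⟩ : (pointIdeal p).primeCompl) := by
    rw [eq_comm, IsLocalization.mk'_eq_iff_eq_mul, sub_mul, IsLocalization.mk'_spec, map_sub,
      map_mul]
  rw [this, IsLocalization.AtPrime.isUnit_mk'_iff]
  refine not_not.2 ((mem_pointIdeal_of_form p (d := d) ?_).2 ?_)
  · rw [← smul_eq_C_mul]
    exact sub_mem num.2 (Submodule.smul_mem _ c den.2)
  · rw [map_sub, map_mul, eval_C, div_mul_cancel₀ _ hden', sub_self]

/-- The fraction `f / l ^ e` of forms of degree `e`, as an element of the local ring. -/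
noncomputable def frac {p : P2 k} {l : Coord k} (hl : l ∈ Form k 1) (hlp : l ∉ pointIdeal p)
    (e : ℕ) : Form k e →ₛₗ[scalar p] LocalRing p where
  toFun f := .mk ⟨e, f, ⟨l ^ e, by simpa using IsHomogeneous.pow hl e⟩,
    (pointIdeal p).primeCompl.pow_mem hlp e⟩
  map_add' f g := by
    apply HomogeneousLocalization.val_injective
    simp only [HomogeneousLocalization.val_add, val_mk_eq, Submodule.coe_add]
    rw [IsLocalization.mk'_eq_mul_mk'_one, map_add, add_mul, ← IsLocalization.mk'_eq_mul_mk'_one,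
      ← IsLocalization.mk'_eq_mul_mk'_one]
  map_smul' c f := by
    apply HomogeneousLocalization.val_injective
    rw [smul_eq_mul, HomogeneousLocalization.val_mul, val_scalar, val_mk_eq, val_mk_eq,
      IsLocalization.mul_mk'_eq_mk'_of_mul]
    simp [smul_eq_C_mul]

theorem exists_mul_mem_of_frac_mem (W : Hilb k n) {p : P2 k} {l : Coord k} (hl : l ∈ Form k 1)
    (hlp : l ∉ pointIdeal p) {e : ℕ} {f : Form k e} (h : frac hl hlp e f ∈ W.localIdeal p) :
    ∃ u ∉ pointIdeal p, u * f.1 ∈ W.ideal := by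
  rw [localIdeal, Ideal.mem_comap, HomogeneousLocalization.algebraMap_apply] at h
  change (HomogeneousLocalization.mk _).val ∈ _ at h
  rw [val_mk_eq] at h
  have h2 := Ideal.mul_mem_right (algebraMap (Coord k) (Localization.AtPrime (pointIdeal p))
    (l ^ e)) _ h
  have h3 := IsLocalization.mk'_spec (Localization.AtPrime (pointIdeal p)) f.1
    (⟨l ^ e, (pointIdeal p).primeCompl.pow_mem hlp e⟩ : (pointIdeal p).primeCompl)
  rw [h3] at h2
  exact (IsLocalization.algebraMap_mem_map_algebraMap_iff (pointIdeal p).primeCompl _ _ _).1 h2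

end Hilb

/-! ### Points and multiplicities of a limit -/

namespace Hilb

open MvPolynomial

variable {k : Type*} [Field k] {n : ℕ}

theorem exists_frame {W : Hilb k n} {d : ℕ}
    (hd : Module.finrank k (Form k d ⧸ degreePart W.ideal d) = n) :
    ∃ A : Frame k (Form k d) n, LinearMap.ker A.1 = degreePart W.ideal d := by
  let E : (Form k d ⧸ degreePart W.ideal d) ≃ₗ[k] (Fin n → k) :=
    LinearEquiv.ofFinrankEq _ _ (by simpa using hd)
  refine ⟨⟨E.toLinearMap ∘ₗ (degreePart W.ideal d).mkQ,
    E.surjective.comp (Submodule.mkQ_surjective _)⟩, ?_⟩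
  simp [LinearMap.ker_comp]

/-- Multiplication by a linear form that does not vanish at any point of `W` is an isomorphism of
the homogeneous coordinate ring of `W` from degree `e` to degree `e + 1`, when both have dimension
`n`. Hence there are forms whose products with the linear form are a dual basis for the quotient
map `A`. -/
theorem exists_dual_forms [IsAlgClosed k] {W : Hilb k n} {e : ℕ}
    (he : Module.finrank k (Form k e ⧸ degreePart W.ideal e) = n)
    {A : Form k (e + 1) →ₗ[k] (Fin n → k)}
    (hA : LinearMap.ker A = degreePart W.ideal (e + 1)) (l : Form k 1)
    (hl : ∀ p ∈ W.support, eval p.rep l.1 ≠ 0) :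
    ∃ b : Fin n → Form k e, ∀ j, A (mulForm e l (b j)) = Pi.single j 1 := by
  have hker : LinearMap.ker (A ∘ₗ mulForm e l) = degreePart W.ideal e := by
    rw [LinearMap.ker_comp, hA]
    ext f
    exact ⟨fun h => W.mem_ideal_of_mul_mem f.2 l.2 hl h, fun h => Ideal.mul_mem_right _ _ h⟩
  have hsurj : Function.Surjective (A ∘ₗ mulForm e l) := by
    rw [← LinearMap.range_eq_top]
    apply Submodule.eq_top_of_finrank_eq
    rw [← (LinearMap.quotKerEquivRange _).finrank_eq, hker, he]
    simp
  choose b hb using fun j => hsurj (Pi.single j 1)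
  exact ⟨b, hb⟩

theorem normForm_of_dual {e : ℕ} {A : Form k (e + 1) → Fin n → k} {b : Fin n → Form k e}
    {l : Form k 1} (hb : ∀ j, A (mulForm e l (b j)) = Pi.single j 1) : normForm A b l = 1 := by
  rw [normForm, ← Matrix.det_one (n := Fin n) (R := k)]
  congr 1
  ext i j
  rw [Matrix.of_apply, hb, Matrix.one_apply, Pi.single_apply]

/-- A subscheme of length `n` that contains `n` distinct points is the reduced subscheme of these
points. -/
theorem eq_ofPoints (W : Hilb k n) {T : Finset (P2 k)} (hT : T.card = n)
    (hsub : ∀ p ∈ T, p ∈ W.support) : W = ofPoints T hT := by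
  have hle : W.ideal ≤ vanishingIdeal T := fun f hf =>
    (mem_vanishingIdeal T f).2 fun p hp => hsub p hp hf
  refine Hilb.ext (le_antisymm hle fun f hf => ?_)
  obtain ⟨d₀, hd₀⟩ := W.length
  have hbig (d : ℕ) (hd : max d₀ n ≤ d) :
      degreePart W.ideal d = degreePart (vanishingIdeal T) d := by
    have hle' : degreePart W.ideal d ≤ degreePart (vanishingIdeal T) d := fun f hf => hle hf
    refine Submodule.eq_of_le_of_finrank_eq hle' ?_
    have h1 := hd₀ d ((le_max_left _ _).trans hd)
    have h2 := finrank_vanishingIdeal T d (hT ▸ (le_max_right _ _).trans hd)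
    have h3 := Submodule.finrank_quotient_add_finrank (degreePart W.ideal d)
    have h4 := Submodule.finrank_quotient_add_finrank (degreePart (vanishingIdeal T) d)
    omega
  have hform (j d : ℕ) (f : Coord k) (hf : f ∈ Form k d) (hfT : f ∈ vanishingIdeal T)
      (hd : max d₀ n ≤ d + j) : f ∈ W.ideal := by
    induction j generalizing d f with
    | zero =>
      have : (⟨f, hf⟩ : Form k d) ∈ degreePart W.ideal d := by
        rw [hbig d hd]; exact hfT
      exact this
    | succ j ih =>
      refine W.saturated f fun i => ih (d + 1) _ ?_ (Ideal.mul_mem_left _ _ hfT) (by omega)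
      rw [mul_comm]
      exact IsHomogeneous.mul hf (isHomogeneous_X k i)
  rw [← f.sum_homogeneousComponent]
  exact Ideal.sum_mem _ fun d _ => hform (max d₀ n) d _ (MvPolynomial.homogeneousComponent_mem d f)
    ((ofPoints T hT).homogeneousComponent_mem hf d) (Nat.le_add_left _ _)

variable [IsAlgClosed k] {W : Hilb k n} {e : ℕ} {z : Fin n → Fin 3 → k}
  {A : Form k (e + 1) →ₗ[k] (Fin n → k)} {g : Matrix (Fin 3) (Fin 3) k} {w : Fin n → P2 k}

/-- The points `w i` of a limit datum lie in the support: a linear form through `w i` that vanishes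
nowhere on the support would have a nonzero norm. -/
theorem mem_support_of_isLimitDatum
    (he : Module.finrank k (Form k e ⧸ degreePart W.ideal e) = n)
    (hA : LinearMap.ker A = degreePart W.ideal (e + 1))
    (h : IsLimitDatum z A g fun i => (w i).rep) (i : Fin n) : w i ∈ W.support := by
  have : Infinite k := IsAlgClosed.instInfinite
  have : Finite W.support := W.finite_support
  by_contra hi
  obtain ⟨l, hl, hli, hls⟩ := exists_linear_form_through (w i) (Subtype.val : W.support → P2 k)
    fun q hq => hi (hq ▸ q.2)
  obtain ⟨l', hl', hne⟩ := exists_linear_form_ne_zero w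
  obtain ⟨b, hb⟩ := exists_dual_forms he hA ⟨l, hl⟩ fun p hp => hls ⟨p, hp⟩
  have h1 := h.2 b ⟨l, hl⟩ ⟨l', hl'⟩
  rw [normForm_of_dual hb, one_mul, Finset.prod_eq_zero (f := fun i => eval (w i).rep l)
    (Finset.mem_univ i) hli, mul_zero] at h1
  exact Finset.prod_ne_zero_iff.2 (fun i _ => hne i) h1

open Classical in
/-- The multiplicity of `W` at `p` is at least the number of indices `i` with `w i = p`. For a
linear form `m` through `p`, the quotients of the values of `m` and of a general linear form `l` at
the points `w i` are the eigenvalues of multiplication by `m / l` on the homogeneous coordinate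
ring of `W`, and the generalized eigenspace for the eigenvalue `0` embeds in the local ring. -/
theorem card_le_multiplicity
    (he : Module.finrank k (Form k e ⧸ degreePart W.ideal e) = n)
    (hA : LinearMap.ker A = degreePart W.ideal (e + 1))
    (h : IsLimitDatum z A g fun i => (w i).rep) (p : P2 k) :
    ((Finset.univ.filter fun i => w i = p).card : ℕ∞) ≤ W.multiplicity p := by
  have : Infinite k := IsAlgClosed.instInfinite
  have : Finite W.support := W.finite_support
  have hAmem (f : Form k (e + 1)) : A f = 0 ↔ f.1 ∈ W.ideal := by
    rw [← LinearMap.mem_ker, hA]; rfl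
  obtain ⟨l, hl, hlne⟩ := exists_linear_form_ne_zero
    (Sum.elim (Subtype.val : W.support → P2 k) (Sum.elim w fun _ : Unit => p))
  have hls : ∀ q ∈ W.support, eval q.rep l ≠ 0 := fun q hq => hlne (.inl ⟨q, hq⟩)
  have hlw : ∀ i, eval (w i).rep l ≠ 0 := fun i => hlne (.inr (.inl i))
  have hlp : l ∉ pointIdeal p := by
    rw [mem_pointIdeal_of_form p hl]
    exact hlne (.inr (.inr ()))
  obtain ⟨m, hm, hmp, hms⟩ := exists_linear_form_through p
    (fun q : {q : W.support // q.1 ≠ p} => q.1.1) fun q => q.2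
  obtain ⟨b, hb⟩ := exists_dual_forms he hA ⟨l, hl⟩ hls
  -- Multiplication by `m / l` in the coordinates given by the forms `b`.
  let T : Matrix (Fin n) (Fin n) k := .of fun i j => A (mulForm e ⟨m, hm⟩ (b j)) i
  have hT : T.charpoly =
      ((Finset.univ.val.map fun i => eval (w i).rep m / eval (w i).rep l).map
        fun a => Polynomial.X - Polynomial.C a).prod := by
    refine Polynomial.funext fun t => ?_
    rw [Matrix.eval_charpoly]
    have hnorm : normForm A b (t • ⟨l, hl⟩ - ⟨m, hm⟩) = (Matrix.scalar (Fin n) t - T).det := by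
      rw [normForm]
      congr 1
      ext i j
      have : mulForm e (t • ⟨l, hl⟩ - ⟨m, hm⟩) (b j) =
          t • mulForm e ⟨l, hl⟩ (b j) - mulForm e ⟨m, hm⟩ (b j) :=
        Subtype.ext (by simp [coe_mulForm, mul_sub])
      rw [Matrix.of_apply, this, map_sub, map_smul, hb]
      simp [T, Pi.single_apply, Matrix.diagonal_apply]
    have h1 := h.2 b (t • ⟨l, hl⟩ - ⟨m, hm⟩) ⟨l, hl⟩
    rw [normForm_of_dual hb, one_mul, hnorm] at h1
    have hprod : ∏ i, eval (w i).rep l ≠ 0 := Finset.prod_ne_zero_iff.2 fun i _ => hlw i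
    rw [← mul_left_inj' hprod, h1, Multiset.map_map, Polynomial.eval_multiset_prod,
      Multiset.map_map]
    change _ = (∏ i, _) * _
    rw [← Finset.prod_mul_distrib]
    refine Finset.prod_congr rfl fun i _ => ?_
    have := hlw i
    simp only [Submodule.coe_sub, Submodule.coe_smul, map_sub, smul_eval, Function.comp_apply,
      Polynomial.eval_sub, Polynomial.eval_X, Polynomial.eval_C]
    field_simp
  let K := Module.End.maxGenEigenspace (Matrix.toLin' T) 0
  have hK : (Finset.univ.filter fun i => w i = p).card ≤ Module.finrank k K := by
    rw [LinearMap.finrank_maxGenEigenspace_eq, Matrix.charpoly_toLin', hT, ← Polynomial.count_roots,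
      Polynomial.roots_multiset_prod_X_sub_C, Multiset.count_map]
    refine Multiset.card_le_card (Multiset.monotone_filter_right _ fun i hi => ?_)
    rw [hi, hmp, zero_div]
  -- The forms of degree `e` with given coordinates.
  let H : (Fin n → k) →ₗ[k] Form k e := Fintype.linearCombination k b
  have hHl (c : Fin n → k) : A (mulForm e ⟨l, hl⟩ (H c)) = c := by
    simp only [H, Fintype.linearCombination_apply, map_sum, map_smul, hb]
    ext i
    simp [Finset.sum_apply, Pi.single_apply]
  have hHm (c : Fin n → k) : A (mulForm e ⟨m, hm⟩ (H c)) = T.mulVec c := by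
    simp only [H, Fintype.linearCombination_apply, map_sum, map_smul]
    ext i
    simp [Finset.sum_apply, T, Matrix.mulVec, dotProduct, mul_comm]
  have hpow (N : ℕ) (c : Fin n → k) :
      m ^ N * (H c).1 - l ^ N * (H ((Matrix.toLin' T ^ N) c)).1 ∈ W.ideal := by
    induction N generalizing c with
    | zero => simp
    | succ N ih =>
      have h1 : (H c).1 * m - (H (Matrix.toLin' T c)).1 * l ∈ W.ideal := by
        rw [← coe_mulForm e ⟨m, hm⟩, ← coe_mulForm e ⟨l, hl⟩, ← Submodule.coe_sub, ← hAmem,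
          map_sub, hHl, hHm, Matrix.toLin'_apply, sub_self]
      have h2 := add_mem (Ideal.mul_mem_left _ (m ^ N) h1)
        (Ideal.mul_mem_left _ l (ih (Matrix.toLin' T c)))
      rw [pow_succ (Matrix.toLin' T), Module.End.mul_apply]
      convert h2 using 1
      ring
  let ψ : K →ₛₗ[scalar p] LocalRing p ⧸ W.localIdeal p :=
    (W.localIdeal p).mkQ.comp ((frac hl hlp e).comp (H ∘ₗ K.subtype))
  have hψ : Function.Injective ψ := by
    rw [injective_iff_map_eq_zero]
    intro c hc
    obtain ⟨u, hu, huI⟩ := W.exists_mul_mem_of_frac_mem hl hlp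
      ((Submodule.Quotient.mk_eq_zero _).1 hc)
    obtain ⟨N, hN⟩ := (Module.End.mem_maxGenEigenspace _ _ _).1 c.2
    rw [zero_smul, sub_zero] at hN
    have hmem : (H c.1).1 ∈ W.ideal := by
      refine W.mem_ideal_of_local (H c.1).2 fun q hq => ?_
      by_cases hqp : q = p
      · subst hqp; exact ⟨u, hu, huI⟩
      · refine ⟨m ^ N, fun hmq => ?_, ?_⟩
        · exact hms ⟨⟨q, hq⟩, hqp⟩ ((mem_pointIdeal_of_form q hm).1 (Ideal.IsPrime.mem_of_pow_mem
            inferInstance N hmq))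
        · have := hpow N c.1
          rwa [hN, map_zero, ZeroMemClass.coe_zero, mul_zero, sub_zero] at this
    have h0 : A (mulForm e ⟨l, hl⟩ (H c.1)) = 0 := (hAmem _).2 (Ideal.mul_mem_right _ _ hmem)
    rw [hHl] at h0
    exact Subtype.ext h0
  exact le_trans (by exact_mod_cast hK)
    (finrank_le_length (scalar p) (exists_sub_scalar_mem p) ψ hψ)

end Hilb

/-! ### Limits of translates -/

section Limit

open MvPolynomial

variable {k : Type*} [Field k]

theorem IsLimitDatum.smul {n e : ℕ} {z : Fin n → Fin 3 → k} {A : Form k (e + 1) → Fin n → k}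
    {g : Matrix (Fin 3) (Fin 3) k} {w : Fin n → Fin 3 → k} (h : IsLimitDatum z A g w)
    (c : Fin n → k) : IsLimitDatum z A g fun i => c i • w i := by
  refine ⟨fun i p q => ?_, fun b l l' => ?_⟩
  · simp only [Pi.smul_apply, smul_eq_mul]
    linear_combination c i * h.1 i p q
  · have (l : Form k 1) (i) : eval (c i • w i) l.1 = c i * eval (w i) l.1 := by
      rw [eval_smul_of_mem_form l.2, pow_one]
    simp only [this, Finset.prod_mul_distrib]
    linear_combination (∏ i, c i) * h.2 b l l'

theorem exists_smul_eq_of_cross_eq {v w : Fin 3 → k} (hw : w ≠ 0)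
    (h : ∀ p q, w p * v q = w q * v p) : ∃ c : k, v = c • w := by
  obtain ⟨q, hq⟩ := Function.ne_iff.1 hw
  refine ⟨v q / w q, funext fun p => ?_⟩
  have hq' : w q ≠ 0 := hq
  rw [Pi.smul_apply, smul_eq_mul]
  field_simp
  linear_combination - h p q

/-- A point `W` of the closure of the orbit of the points `z i` comes with a nonzero linear map `f`
and points `w i` of `W`, no more of them at each point than its multiplicity, such that `w i` is
the image of `z i` under `f` whenever this image is defined. -/
theorem exists_limit_of_mem_closure_orbit [IsAlgClosed k] {n : ℕ} {Z : Finset (P2 k)}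
    (hZ : Z.card = n) {z : Fin n → P2 k} (hz : Set.range z = Z) {W : Hilb k n}
    (hW : W ∈ closure (orbit Z hZ)) :
    ∃ (f : (Fin 3 → k) →ₗ[k] (Fin 3 → k)) (w : Fin n → P2 k), f ≠ 0 ∧
      (∀ i, ∃ c : k, f (z i).rep = c • (w i).rep) ∧ (∀ i, w i ∈ W.support) ∧
      ∀ (p : P2 k) (s : Finset (Fin n)), (∀ i ∈ s, w i = p) → (s.card : ℕ∞) ≤ W.multiplicity p := by
  classical
  obtain ⟨d₀, hd₀⟩ := W.length
  set e := max d₀ n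
  have he := hd₀ e (le_max_left _ _)
  obtain ⟨A, hA⟩ := Hilb.exists_frame (hd₀ (e + 1) (Nat.le_succ_of_le (le_max_left _ _)))
  obtain ⟨g, w, hg, hw, h⟩ := hasLimitDatum_of_mem_closure_orbit hZ hz hW
    (Nat.le_succ_of_le (le_max_right d₀ n)) A hA
  choose c hc using fun i => Projectivization.exists_smul_eq_mk_rep k (w i) (hw i)
  let w' (i : Fin n) : P2 k := .mk k (w i) (hw i)
  have h' : IsLimitDatum (fun i => (z i).rep) A.1 g fun i => (w' i).rep := by
    have := h.smul fun i => (c i : k)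
    convert this using 2 with i
    exact (hc i).symm
  refine ⟨Matrix.toLin' g, w', by simpa using hg, fun i => ?_,
    Hilb.mem_support_of_isLimitDatum he hA h', fun p s hs => ?_⟩
  · rw [Matrix.toLin'_apply]
    exact exists_smul_eq_of_cross_eq (w' i).rep_nonzero (h'.1 i)
  · refine le_trans ?_ (Hilb.card_le_multiplicity he hA h' p)
    exact_mod_cast Finset.card_le_card fun i hi => Finset.mem_filter.2 ⟨Finset.mem_univ _, hs i hi⟩

end Limit

/-! ### Degenerate linear images of six points -/

section Configuration

variable {k : Type*} [Field k]

theorem NoThreeCollinear.linearIndependent {Z : Finset (P2 k)} (h : NoThreeCollinear Z)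
    {a b c : P2 k} (ha : a ∈ Z) (hb : b ∈ Z) (hc : c ∈ Z) (hab : a ≠ b) (hac : a ≠ c)
    (hbc : b ≠ c) : LinearIndependent k ![a.rep, b.rep, c.rep] := by
  have h2 : LinearIndependent k ![b.rep, c.rep] :=
    (Projectivization.linearIndependent_pair_iff_ne).2 hbc
  rw [Matrix.vecCons, linearIndependent_finCons]
  refine ⟨h2, fun hmem => h a ha b hb c hc hab hac hbc
    ⟨Submodule.span k (Set.range ![b.rep, c.rep]), ?_, ?_, ?_, ?_⟩⟩
  · rw [IsLine, finrank_span_eq_card h2, Fintype.card_fin]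
  · rw [LiesOn, Projectivization.submodule_eq, Submodule.span_singleton_le_iff_mem]
    exact hmem
  · rw [LiesOn, Projectivization.submodule_eq, Submodule.span_singleton_le_iff_mem]
    exact Submodule.subset_span ⟨0, rfl⟩
  · rw [LiesOn, Projectivization.submodule_eq, Submodule.span_singleton_le_iff_mem]
    exact Submodule.subset_span ⟨1, rfl⟩

/-- A map on six elements with at most three values and with fibres of at most two elements groups
the six elements into three pairs. -/
theorem exists_pairing {β : Type*} [DecidableEq β] (f : Fin 6 → β)
    (hfib : ∀ i j l, i ≠ j → i ≠ l → j ≠ l → f i = f j → f i ≠ f l)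
    (hcard : (Finset.univ.image f).card ≤ 3) :
    ∃ σ : Fin 6 → Fin 6, Function.Injective σ ∧ f (σ 0) = f (σ 1) ∧ f (σ 2) = f (σ 3) ∧
      f (σ 4) = f (σ 5) := by
  have hle : ∀ y ∈ Finset.univ.image f, (Finset.univ.filter fun i => f i = y).card ≤ 2 := by
    intro y _
    by_contra! h
    obtain ⟨i, j, l, hi, hj, hl, hij, hil, hjl⟩ := Finset.two_lt_card_iff.1 h
    simp only [Finset.mem_filter, Finset.mem_univ, true_and] at hi hj hl
    exact hfib i j l hij hil hjl (hi.trans hj.symm) (hi.trans hl.symm)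
  have hsum := Finset.card_eq_sum_card_image f Finset.univ
  rw [Finset.card_univ, Fintype.card_fin] at hsum
  have h3 : (Finset.univ.image f).card = 3 := by
    have := Finset.sum_le_card_nsmul _ _ 2 hle
    rw [← hsum, smul_eq_mul] at this
    omega
  have h2 : ∀ y ∈ Finset.univ.image f, (Finset.univ.filter fun i => f i = y).card = 2 := by
    refine (Finset.sum_eq_sum_iff_of_le hle).1 ?_
    rw [← hsum, Finset.sum_const, h3, smul_eq_mul]
  obtain ⟨x, y, t, hxy, hxt, hyt, himg⟩ := Finset.card_eq_three.1 h3
  have hpair : ∀ y ∈ Finset.univ.image f, ∃ a b, a ≠ b ∧ f a = y ∧ f b = y := by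
    intro y hy
    obtain ⟨a, b, hab, heq⟩ := Finset.card_eq_two.1 (h2 y hy)
    have ha : a ∈ Finset.univ.filter fun i => f i = y := by simp [heq]
    have hb : b ∈ Finset.univ.filter fun i => f i = y := by simp [heq]
    exact ⟨a, b, hab, (Finset.mem_filter.1 ha).2, (Finset.mem_filter.1 hb).2⟩
  obtain ⟨a₁, b₁, h₁, ha₁, hb₁⟩ := hpair x (by simp [himg])
  obtain ⟨a₂, b₂, h₂, ha₂, hb₂⟩ := hpair y (by simp [himg])
  obtain ⟨a₃, b₃, h₃, ha₃, hb₃⟩ := hpair t (by simp [himg])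
  refine ⟨![a₁, b₁, a₂, b₂, a₃, b₃], ?_, ha₁.trans hb₁.symm, ha₂.trans hb₂.symm,
    ha₃.trans hb₃.symm⟩
  have hne {i j : Fin 6} (h : f i ≠ f j) : i ≠ j := fun hij => h (hij ▸ rfl)
  have hne12 : f a₁ ≠ f a₂ := by rwa [ha₁, ha₂]
  have hne13 : f a₁ ≠ f a₃ := by rwa [ha₁, ha₃]
  have hne23 : f a₂ ≠ f a₃ := by rwa [ha₂, ha₃]
  rw [← List.nodup_ofFn]
  simp only [List.ofFn_succ, List.ofFn_zero, Matrix.cons_val_zero, Matrix.cons_val_succ,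
    List.nodup_cons, List.mem_cons, List.not_mem_nil, or_false, not_or, List.nodup_nil]
  grind

variable {z : Fin 6 → P2 k} {f : (Fin 3 → k) →ₗ[k] (Fin 3 → k)} {w : Fin 6 → P2 k}

theorem four_le_card_of_rank_one
    (hli : ∀ i j l, i ≠ j → i ≠ l → j ≠ l →
      LinearIndependent k ![(z i).rep, (z j).rep, (z l).rep])
    (hw : ∀ i, ∃ c : k, f (z i).rep = c • (w i).rep)
    (hrank : Module.finrank k (LinearMap.range f) = 1) :
    ∃ (p : P2 k) (s : Finset (Fin 6)), (∀ i ∈ s, w i = p) ∧ 4 ≤ s.card := by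
  classical
  let N := Finset.univ.filter fun i => f (z i).rep = 0
  have hN : N.card ≤ 2 := by
    by_contra! h
    obtain ⟨i, j, l, hi, hj, hl, hij, hil, hjl⟩ := Finset.two_lt_card_iff.1 h
    have hspan : Submodule.span k (Set.range ![(z i).rep, (z j).rep, (z l).rep]) ≤
        LinearMap.ker f := by
      rw [Submodule.span_le]
      rintro _ ⟨t, rfl⟩
      fin_cases t
      · exact (Finset.mem_filter.1 hi).2
      · exact (Finset.mem_filter.1 hj).2
      · exact (Finset.mem_filter.1 hl).2
    have h1 := Submodule.finrank_mono hspan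
    rw [finrank_span_eq_card (hli i j l hij hil hjl)] at h1
    have h2 := f.finrank_range_add_finrank_ker
    simp only [Fintype.card_fin, Module.finrank_fin_fun] at h1 h2
    omega
  obtain ⟨v, hv, hspan⟩ := finrank_eq_one_iff'.1 hrank
  have hv0 : v.1 ≠ 0 := fun h => hv (Subtype.ext h)
  refine ⟨.mk k v.1 hv0, Nᶜ, fun i hi => ?_, ?_⟩
  · have hi0 : f (z i).rep ≠ 0 := by simpa [N] using hi
    obtain ⟨c, hc⟩ := hw i
    obtain ⟨d, hd⟩ := hspan ⟨f (z i).rep, LinearMap.mem_range_self f _⟩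
    have hd' : d • v.1 = f (z i).rep := congr_arg Subtype.val hd
    have hc0 : c ≠ 0 := by rintro rfl; exact hi0 (by rw [hc, zero_smul])
    rw [← (w i).mk_rep, Projectivization.mk_eq_mk_iff']
    exact ⟨c⁻¹ * d, by rw [mul_smul, hd', hc, smul_smul, inv_mul_cancel₀ hc0, one_smul]⟩
  · rw [Finset.card_compl, Fintype.card_fin]
    omega

/-- Two points with the same image under the projection with center `q` are collinear with `q`. -/
theorem center_eq_combination_of_eq (hw : ∀ i, ∃ c : k, f (z i).rep = c • (w i).rep)
    (hli : ∀ i j, i ≠ j → LinearIndependent k ![(z i).rep, (z j).rep]) {q : Fin 3 → k}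
    (hq : LinearMap.ker f = Submodule.span k {q}) {i j : Fin 6} (hij : i ≠ j)
    (hi : f (z i).rep ≠ 0) (hj : f (z j).rep ≠ 0) (h : w i = w j) :
    ∃ a b : k, b ≠ 0 ∧ q = a • (z i).rep + b • (z j).rep := by
  obtain ⟨c, hc⟩ := hw i
  obtain ⟨d, hd⟩ := hw j
  have hc0 : c ≠ 0 := by rintro rfl; exact hi (by rw [hc, zero_smul])
  have hd0 : d ≠ 0 := by rintro rfl; exact hj (by rw [hd, zero_smul])
  have hmem : d • (z i).rep - c • (z j).rep ∈ LinearMap.ker f := by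
    rw [LinearMap.mem_ker, map_sub, map_smul, map_smul, hc, hd, h, smul_smul, smul_smul, mul_comm,
      sub_self]
  rw [hq] at hmem
  obtain ⟨t, ht⟩ := Submodule.mem_span_singleton.1 hmem
  have ht0 : t ≠ 0 := by
    rintro rfl
    rw [zero_smul] at ht
    have := LinearIndependent.pair_iff.1 (hli i j hij) d (-c) (by rw [ht, neg_smul, sub_eq_add_neg])
    exact hd0 this.1
  refine ⟨t⁻¹ * d, -(t⁻¹ * c), neg_ne_zero.2 (mul_ne_zero (inv_ne_zero ht0) hc0), ?_⟩
  have : q = t⁻¹ • (t • q) := by rw [smul_smul, inv_mul_cancel₀ ht0, one_smul]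
  rw [this, ht]
  module

theorem eq_zero_of_triple {V : Type*} [AddCommGroup V] [Module k V] {x y t : V}
    (h : LinearIndependent k ![x, y, t]) {a b c : k} (h0 : a • x + b • y + c • t = 0) :
    a = 0 ∧ b = 0 ∧ c = 0 := by
  have := Fintype.linearIndependent_iff.1 h ![a, b, c] (by simpa [Fin.sum_univ_three] using h0)
  exact ⟨this 0, this 1, this 2⟩

/-- The projection of six points from a point `q` that is not a star point has at least four
distinct values: each of its fibres spans a line through `q`, so either `q` is one of the points and
the other five have distinct images, or the fibres have at most two elements and are not three
pairs. -/
theorem four_le_card_of_rank_two [DecidableEq (P2 k)] [DecidableEq (Fin 3 → k)]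
    (hz : Function.Injective z)
    (hli : ∀ i j l, i ≠ j → i ≠ l → j ≠ l →
      LinearIndependent k ![(z i).rep, (z j).rep, (z l).rep])
    (hw : ∀ i, ∃ c : k, f (z i).rep = c • (w i).rep) {q : Fin 3 → k}
    (hq : LinearMap.ker f = Submodule.span k {q})
    (hstar : (∀ i, f (z i).rep ≠ 0) → ¬ ∃ σ : Fin 6 → Fin 6, Function.Injective σ ∧
      q ∈ Submodule.span k {(z (σ 0)).rep} ⊔ Submodule.span k {(z (σ 1)).rep} ∧
      q ∈ Submodule.span k {(z (σ 2)).rep} ⊔ Submodule.span k {(z (σ 3)).rep} ∧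
      q ∈ Submodule.span k {(z (σ 4)).rep} ⊔ Submodule.span k {(z (σ 5)).rep}) :
    4 ≤ ((Finset.univ.filter fun i => f (z i).rep ≠ 0).image w).card := by
  have hli2 (i j) (hij : i ≠ j) : LinearIndependent k ![(z i).rep, (z j).rep] :=
    (Projectivization.linearIndependent_pair_iff_ne).2 (hz.ne hij)
  by_cases h : ∀ i, f (z i).rep ≠ 0
  · rw [Finset.filter_true_of_mem fun i _ => h i]
    by_contra! hcard
    have hfib (i j l) (hij : i ≠ j) (hil : i ≠ l) (hjl : j ≠ l) (hwij : w i = w j) :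
        w i ≠ w l := by
      intro hwil
      obtain ⟨a, b, hb, hab⟩ := center_eq_combination_of_eq hw hli2 hq hij (h i) (h j) hwij
      obtain ⟨a', b', -, hab'⟩ := center_eq_combination_of_eq hw hli2 hq hil (h i) (h l) hwil
      refine hb (eq_zero_of_triple (hli i j l hij hil hjl) (a := a - a') (c := -b') ?_).2.1
      rw [← sub_eq_zero.2 (hab.symm.trans hab')]
      module
    obtain ⟨σ, hσ, h0, h1, h2⟩ := exists_pairing w hfib (by omega)
    have key (i j) (hij : i ≠ j) (hwij : w i = w j) :
        q ∈ Submodule.span k {(z i).rep} ⊔ Submodule.span k {(z j).rep} := by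
      obtain ⟨a, b, -, hab⟩ := center_eq_combination_of_eq hw hli2 hq hij (h i) (h j) hwij
      exact hab ▸ Submodule.add_mem_sup
        (Submodule.smul_mem _ _ (Submodule.mem_span_singleton_self _))
        (Submodule.smul_mem _ _ (Submodule.mem_span_singleton_self _))
    exact hstar h ⟨σ, hσ, key _ _ (hσ.ne (by decide)) h0, key _ _ (hσ.ne (by decide)) h1,
      key _ _ (hσ.ne (by decide)) h2⟩
  · push Not at h
    obtain ⟨i₀, hi₀⟩ := h
    obtain ⟨d, hd⟩ := Submodule.mem_span_singleton.1 (hq ▸ LinearMap.mem_ker.2 hi₀)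
    have hS (j) (hj : j ≠ i₀) : f (z j).rep ≠ 0 := by
      intro h0
      obtain ⟨d', hd'⟩ := Submodule.mem_span_singleton.1 (hq ▸ LinearMap.mem_ker.2 h0)
      have := LinearIndependent.pair_iff.1 (hli2 j i₀ hj) d (-d') (by rw [← hd, ← hd']; module)
      rw [this.1, zero_smul] at hd
      exact (z i₀).rep_nonzero hd.symm
    have hinj : Set.InjOn w (Finset.univ.erase i₀ : Finset (Fin 6)) := by
      intro i hi j hj hij
      by_contra hne
      have hi' := Finset.ne_of_mem_erase hi
      have hj' := Finset.ne_of_mem_erase hj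
      obtain ⟨a, b, -, hab⟩ := center_eq_combination_of_eq hw hli2 hq hne (hS i hi') (hS j hj') hij
      have := eq_zero_of_triple (hli i j i₀ hne hi' hj') (a := d * a) (b := d * b) (c := -1) (by
        rw [← hd, hab]; module)
      exact neg_ne_zero.2 one_ne_zero this.2.2
    calc 4 ≤ (Finset.univ.erase i₀ : Finset (Fin 6)).card := by simp
      _ = ((Finset.univ.erase i₀).image w).card := (Finset.card_image_of_injOn hinj).symm
      _ ≤ _ := Finset.card_le_card (Finset.image_subset_image fun i hi =>
        Finset.mem_filter.2 ⟨Finset.mem_univ _, hS i (Finset.ne_of_mem_erase hi)⟩)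

end Configuration

end SixPoints

open SixPoints in
theorem proposition5p5 {k : Type*} [Field k] [IsAlgClosed k] [CharZero k]
    (Z : Finset (SixPoints.P2 k)) (hZ : Z.card = 6)
    (hcol : SixPoints.NoThreeCollinear Z) (hstar : SixPoints.StarFree Z)
    (W : SixPoints.Hilb k 6)
    (hW : W ∈ closure (SixPoints.orbit Z hZ)) (hW' : W ∉ SixPoints.orbit Z hZ) :
    (∃ L : Submodule k (Fin 3 → k), SixPoints.IsLine L ∧
      4 ≤ {p | p ∈ W.support ∧ SixPoints.LiesOn p L}.encard) ∨
    ∃ p : SixPoints.P2 k, 4 ≤ W.multiplicity p := by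
  classical
  let z (i : Fin 6) : P2 k := ((Z.equivFinOfCardEq hZ).symm i).1
  have hzinj : Function.Injective z :=
    Subtype.val_injective.comp (Z.equivFinOfCardEq hZ).symm.injective
  have hzmem (i : Fin 6) : z i ∈ Z := ((Z.equivFinOfCardEq hZ).symm i).2
  have hzrange : Set.range z = Z := by
    ext p
    refine ⟨fun ⟨i, hi⟩ => hi ▸ hzmem i, fun hp => ⟨Z.equivFinOfCardEq hZ ⟨p, hp⟩, ?_⟩⟩
    simp [z]
  have hli (i j l) (hij : i ≠ j) (hil : i ≠ l) (hjl : j ≠ l) :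
      LinearIndependent k ![(z i).rep, (z j).rep, (z l).rep] :=
    hcol.linearIndependent (hzmem i) (hzmem j) (hzmem l) (hzinj.ne hij) (hzinj.ne hil)
      (hzinj.ne hjl)
  obtain ⟨f, w, hf, hw, hsupp, hmult⟩ := exists_limit_of_mem_closure_orbit hZ hzrange hW
  have hdim := f.finrank_range_add_finrank_ker
  rw [Module.finrank_fin_fun] at hdim
  have hrange0 : Module.finrank k (LinearMap.range f) ≠ 0 := fun h0 =>
    hf (LinearMap.range_eq_bot.1 (Submodule.finrank_eq_zero.1 h0))
  -- Nonzero images of the points of `Z` are points of `W`.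
  have hmk (i) (hi : f (z i).rep ≠ 0) : w i = .mk k (f (z i).rep) hi := by
    obtain ⟨c, hc⟩ := hw i
    have hc0 : c ≠ 0 := by rintro rfl; exact hi (by rw [hc, zero_smul])
    conv_lhs => rw [← (w i).mk_rep]
    rw [Projectivization.mk_eq_mk_iff']
    exact ⟨c⁻¹, by rw [hc, smul_smul, inv_mul_cancel₀ hc0, one_smul]⟩
  obtain h3 | h2 | h1 : Module.finrank k (LinearMap.range f) = 3 ∨
      Module.finrank k (LinearMap.range f) = 2 ∨ Module.finrank k (LinearMap.range f) = 1 := by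
    omega
  · -- If the limit matrix is invertible, then `W` is a translate of `Z`.
    refine absurd ?_ hW'
    have hker : LinearMap.ker f = ⊥ := Submodule.finrank_eq_zero.1 (by omega)
    have hdet : (LinearMap.toMatrix' f).det ≠ 0 := by
      rw [LinearMap.det_toMatrix']
      exact (LinearMap.isUnit_det f ((LinearMap.isUnit_iff_ker_eq_bot f).2 hker)).ne_zero
    let G : GL (Fin 3) k := Matrix.GeneralLinearGroup.mkOfDetNeZero _ hdet
    refine ⟨Matrix.ProjGenLinGroup.mk G, (Hilb.eq_ofPoints W _ fun p hp => ?_).symm⟩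
    obtain ⟨q, hq, rfl⟩ := Finset.mem_map.1 hp
    obtain ⟨i, rfl⟩ : q ∈ Set.range z := by rw [hzrange]; exact hq
    have hi : f (z i).rep ≠ 0 := fun h0 =>
      (z i).rep_nonzero ((LinearMap.ker_eq_bot'.1 hker) _ h0)
    have : (MulAction.toPerm (Matrix.ProjGenLinGroup.mk G)).toEmbedding (z i) = w i := by
      rw [hmk i hi]
      conv_lhs => rw [← (z i).mk_rep]
      change Projectivization.mk k (G.1.mulVec (z i).rep) _ = _
      congr 1
      exact LinearMap.toMatrix'_mulVec f _
    rw [this]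
    exact hsupp i
  · -- If it has rank two, it projects `Z` from a point to a line.
    left
    refine ⟨LinearMap.range f, h2, ?_⟩
    obtain ⟨q, hq0, hq⟩ := finrank_eq_one_iff'.1
      (show Module.finrank k (LinearMap.ker f) = 1 by omega)
    have hker : LinearMap.ker f = Submodule.span k {q.1} := by
      refine le_antisymm (fun v hv => ?_)
        ((Submodule.span_singleton_le_iff_mem _ _).2 q.2)
      obtain ⟨c, hc⟩ := hq ⟨v, hv⟩
      exact Submodule.mem_span_singleton.2 ⟨c, congr_arg Subtype.val hc⟩
    have hcard := four_le_card_of_rank_two hzinj hli hw hker ?_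
    · refine le_trans ?_ (Set.encard_le_encard (s := (((Finset.univ.filter fun i =>
        f (z i).rep ≠ 0).image w : Finset (P2 k)) : Set (P2 k))) ?_)
      · rw [Set.encard_coe_eq_coe_finsetCard]
        exact_mod_cast hcard
      · intro p hp
        obtain ⟨i, hi, rfl⟩ := Finset.mem_image.1 hp
        refine ⟨hsupp i, ?_⟩
        rw [hmk i (Finset.mem_filter.1 hi).2, LiesOn, Projectivization.submodule_mk,
          Submodule.span_singleton_le_iff_mem]
        exact LinearMap.mem_range_self f _
    · rintro hne ⟨σ, hσ, h⟩
      have hq1 : q.1 ≠ 0 := fun h0 => hq0 (Subtype.ext h0)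
      refine hstar (.mk k q.1 hq1) ⟨fun hqZ => ?_, z ∘ σ, hzinj.comp hσ, ?_, ?_⟩
      · obtain ⟨i, hi⟩ : Projectivization.mk k q.1 hq1 ∈ Set.range z := by
          rw [hzrange]; exact hqZ
        obtain ⟨c, hc⟩ := Projectivization.exists_smul_eq_mk_rep k q.1 hq1
        refine hne i ?_
        rw [hi, ← hc, Units.smul_def, map_smul, LinearMap.mem_ker.1 q.2, smul_zero]
      · rw [Set.range_comp, (Finite.injective_iff_surjective.1 hσ).range_eq, Set.image_univ,
          hzrange]
      · simp only [LiesOn, join, Projectivization.submodule_mk,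
          Submodule.span_singleton_le_iff_mem]
        simpa only [Projectivization.submodule_eq, Function.comp_apply] using h
  · -- If it has rank one, it maps `Z` to a point, except for points of `Z` on a line.
    right
    obtain ⟨p, s, hs, h4⟩ := four_le_card_of_rank_one hli hw h1
    exact ⟨p, le_trans (by exact_mod_cast h4) (hmult p s hs)⟩
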